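/- \textbf{Setting.} An instance of Max-2CSP consists of variables $x_1,\dots,x_n$ with values in $\{0,1\}$ and $m$ constraints; the $i$-th constraint is a relation $R_i\subseteq\{0,1\}^2$ applied to a pair $t_i$ of variables, and has a weight $w_i$. The objective value of an assignment $\tau$ is the total weight of the constraints that it satisfies. In an instance of the Binary Function Optimization Problem (BFOP) the constraints are replaced by functions $f_i$ of two arguments in $\{0,1\}$, applied to pairs $t_i$ of variables, and the objective value of $\tau$ is $\sum_{i=1}^m w_i f_i(\tau(t_i))$. The function values of a BFOP instance are assumed to lie either in a fixed finite set of real numbers, or in $\{0,1,\dots,k\}$ with $k\le q(n)$ for a fixed polynomial $q$. FLIP starts from an arbitrary assignment and, as long as flipping the value of some single variable strictly increases the objective value, performs one such flip; an implementation is any choice of the initial assignment and of the rule that picks the next variable to flip. \textbf{Theorem.} Let $\phi>0$, and let the weights $w_1,\dots,w_m$ be independent random variables, where the distribution of each $w_i$ is supported on $[-1,1]$ and has a density bounded by $\phi$. Then for every instance of Max-2CSP or of BFOP with $n$ variables and $m$ constraints (functions), with probability at least $1-o_n(1)$ over the draw of the weights, every implementation of FLIP takes at most $\phi\cdot m\cdot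 n^{O(\sqrt{\log n})}$ steps to terminate. Here $o_n(1)$ is a function of $n$ that tends to $0$ as $n\to\infty$; this function and the constant in $O(\cdot)$ are absolute in the case of Max-2CSP, and in the case of BFOP depend only on the fixed finite set of values, respectively on the polynomial $q$. -/

import Mathlib

open MeasureTheory Filter Topology
open scoped ENNReal

/-- Assignments of values in the binary domain `{0,1}` (`false`, `true`) to `n` variables. -/
abbrev Assignment (n : ℕ) : Type := Fin n → Bool

/-- Flip the value of the variable `j`. -/
def Assignment.flipAt {n : ℕ} (τ : Assignment n) (j : Fin n) : Assignment n :=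
  Function.update τ j (!(τ j))

/-- An instance, without its weights, of the Binary Function Optimization Problem with `n` variables
and `m` functions: each function has two Boolean arguments and is applied to a pair of variables.
(The two variables may coincide, and different functions may use the same pair.) -/
structure BFOP (n m : ℕ) where
  /-- the pair of variables of each function -/
  scope : Fin m → Fin n × Fin n
  /-- the functions -/
  func : Fin m → Bool → Bool → ℝ

/-- The objective: the weighted sum of the functions. -/
def BFOP.objective {n m : ℕ} (I : BFOP n m) (w : Fin m → ℝ) (τ : Assignment n) : ℝ :=
  ∑ i, w i * I.func i (τ (I.scope i).1) (τ (I.scope i).2)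

/-- An instance, without its weights, of Max-2CSP with `n` variables and `m` constraints: each
constraint is a pair of variables together with a binary relation over `{0,1}`. -/
structure Max2CSP (n m : ℕ) where
  /-- the pair of variables of each constraint -/
  scope : Fin m → Fin n × Fin n
  /-- the relation of each constraint -/
  rel : Fin m → Set (Bool × Bool)

open Classical in
/-- The objective: the total weight of the satisfied constraints. -/
noncomputable def Max2CSP.objective {n m : ℕ} (I : Max2CSP n m) (w : Fin m → ℝ)
    (τ : Assignment n) : ℝ :=
  ∑ i, if (τ (I.scope i).1, τ (I.scope i).2) ∈ I.rel i then w i else 0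

/-- A step of FLIP: one variable is flipped, and this strictly increases the objective. -/
def IsFlipStep {n : ℕ} (obj : Assignment n → ℝ) (τ τ' : Assignment n) : Prop :=
  (∃ j : Fin n, τ' = τ.flipAt j) ∧ obj τ < obj τ'

/-- Every implementation of FLIP takes at most `T` steps to terminate: no sequence of FLIP steps,
from whatever initial assignment and whatever variable is picked (by whatever pivoting rule, adaptive
or randomized) when several flips are improving, has more than `T` steps. -/
def FlipTerminatesWithin {n : ℕ} (obj : Assignment n → ℝ) (T : ℝ) : Prop :=
  ∀ (ℓ : ℕ) (τ : ℕ → Assignment n),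
    (∀ t < ℓ, IsFlipStep obj (τ t) (τ (t + 1))) → (ℓ : ℝ) ≤ T

/-- `μ` is a probability distribution supported on `[-1,1]` that has a density bounded by `φ`. -/
structure IsSmoothWeightLaw (φ : ℝ) (μ : Measure ℝ) : Prop where
  isProbabilityMeasure : IsProbabilityMeasure μ
  supported : μ (Set.Icc (-1) 1)ᶜ = 0
  density : ∃ f : ℝ → ℝ≥0∞, Measurable f ∧ μ = volume.withDensity f ∧ ∀ x, f x ≤ ENNReal.ofReal φ

/-- With the weights drawn independently, the `i`-th from `μ i`, with probability at least `p` every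
implementation of FLIP for the objective `obj w` given by the drawn weights `w` takes at most `T`
steps. -/
def FlipFastWithProb {n m : ℕ} (obj : (Fin m → ℝ) → Assignment n → ℝ) (μ : Fin m → Measure ℝ)
    (T p : ℝ) : Prop :=
  p ≤ (Measure.pi μ).real {w | FlipTerminatesWithin (obj w) T}

/-! Consider two consecutive flips of a variable `v` (an arc). At both times the gain is the
absolute value of the slope of the objective in direction `v`, and the slope has opposite signs,
since `v` has opposite values. The two gains therefore add up, up to sign, to the difference of the
two slopes. This is a linear form in the weights: its coefficients are mixed second differences
times the changes of the neighbours of `v` (`BFOP.slope_sub_slope`). If all gains in a block of `L`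
flips are at most `ε`, then every arc in the block gives a form of absolute value at most `2 * ε`.

Choose rows (arcs) in triangular form: every nonempty subset has a row whose pivot weight occurs in
no other row of the subset. The probability that `r` such forms are all small is an `r`-th power
(`pi_measure_forms_le`). The union bound pays for a description of the forms: a list of `N` flips
with their variables and values, and the two ends of each arc. A form is determined by the first and
last flip of each neighbour within its arc. If `N` is at most a multiple of `D * r`, where `D` is
about `√(log n)`, each row costs a factor `n ^ O(D)`, and `ε = n ^ (-O(D))` up to the factor `κ / φ`
suffices.

The combinatorial core, `FlipTrace.exists_triangular_recorded`, finds such rows in every block of `2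
^ (D ^ 2 + D)` flips. Suppose they are always too expensive. Recording a whole window shows that no
window contains many rows in order. Double counting over `D` dyadic scales then makes arcs next to a
much shorter arc of the same variable rare, and likewise arcs containing an isolated flip of a
neighbour. Among the remaining arcs, averaging gives a scale `k` and a cut crossed by many arcs of
that scale, with few arc ends of similar scale nearby. These arcs belong to distinct variables, and
the flips needed to describe them fall into a few families, each bounded by expensiveness or by
averaging. They are too few, a contradiction.

Outside the exceptional event every block gains more than `ε`, and the bounded range of the
objective limits the number of blocks (`BFOP.steps_le`). -/

/-! ### Arcs and flip sequences -/

/-- Two consecutive occurrences of the same letter in the sequence `σ`. -/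
def IsArc {V : Type*} (σ : ℕ → V) (i j : ℕ) : Prop :=
  i < j ∧ σ i = σ j ∧ ∀ t, i < t → t < j → σ t ≠ σ i

/-- A sequence of `L` flips of Boolean variables indexed by `Fin n`, together with an interaction
graph, such that between two consecutive flips of a variable some neighbour of it changes. -/
structure FlipTrace (n : ℕ) where
  σ : ℕ → Fin n
  x : ℕ → Fin n → Bool
  L : ℕ
  adj : Fin n → Fin n → Prop
  adj_symm : ∀ {u v}, adj u v → adj v u
  adj_ne : ∀ {u v}, adj u v → u ≠ v
  step : ∀ t < L, x (t + 1) = Function.update (x t) (σ t) (!(x t (σ t)))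
  exists_change : ∀ i j, IsArc σ i j → j < L → ∃ u, adj (σ i) u ∧ x i u ≠ x j u

namespace IsArc

variable {V : Type*} {σ : ℕ → V} {i j i' j' : ℕ}

lemma lt (h : IsArc σ i j) : i < j := h.1

lemma eq (h : IsArc σ i j) : σ i = σ j := h.2.1

lemma ne (h : IsArc σ i j) {t : ℕ} (h1 : i < t) (h2 : t < j) : σ t ≠ σ i := h.2.2 t h1 h2

lemma le_of_lt (h : IsArc σ i j) {t : ℕ} (h1 : i < t) (h2 : σ t = σ i) : j ≤ t := by
  by_contra hc
  exact h.ne h1 (by omega) h2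

lemma le_of_lt' (h : IsArc σ i j) {t : ℕ} (h1 : t < j) (h2 : σ t = σ i) : t ≤ i := by
  by_contra hc
  exact h.ne (by omega) h1 h2

lemma fst_unique (h : IsArc σ i j) (h' : IsArc σ i' j) : i = i' := by
  have h1 := h.le_of_lt' h'.lt (by rw [h'.eq, h.eq])
  have h2 := h'.le_of_lt' h.lt (by rw [h'.eq, h.eq])
  omega

lemma snd_unique (h : IsArc σ i j) (h' : IsArc σ i j') : j = j' := by
  have h1 := h.le_of_lt h'.lt h'.eq.symm
  have h2 := h'.le_of_lt h.lt h.eq.symm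
  omega

end IsArc

lemma exists_isArc_left {V : Type*} {σ : ℕ → V} {s t : ℕ} (hst : s < t) (h : σ s = σ t) :
    ∃ r, s ≤ r ∧ IsArc σ r t := by
  classical
  have hex : ∃ d, d < t ∧ σ (t - 1 - d) = σ t := ⟨t - 1 - s, by omega, by
    rw [show t - 1 - (t - 1 - s) = s by omega, h]⟩
  obtain ⟨hd, he⟩ := Nat.find_spec hex
  have hmin : ∀ m < Nat.find hex, ¬ _ := fun m hm => Nat.find_min hex hm
  set d := Nat.find hex
  have hle : d ≤ t - 1 - s := Nat.find_min' hex ⟨by omega, by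
    rw [show t - 1 - (t - 1 - s) = s by omega, h]⟩
  refine ⟨t - 1 - d, by omega, by omega, he, fun r h1 h2 h3 => ?_⟩
  refine hmin (t - 1 - r) (by omega) ⟨by omega, ?_⟩
  rw [show t - 1 - (t - 1 - r) = r by omega, h3, he]

lemma exists_isArc_right {V : Type*} {σ : ℕ → V} {s t : ℕ} (hst : s < t) (h : σ s = σ t) :
    ∃ r, r ≤ t ∧ IsArc σ s r := by
  classical
  have hex : ∃ r, s < r ∧ σ r = σ s := ⟨t, hst, h.symm⟩
  obtain ⟨h1, h2⟩ := Nat.find_spec hex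
  refine ⟨Nat.find hex, Nat.find_min' hex ⟨hst, h.symm⟩, h1, h2.symm, fun r hr1 hr2 hr3 => ?_⟩
  exact Nat.find_min hex hr2 ⟨hr1, hr3⟩

namespace FlipTrace

variable {n : ℕ} (T : FlipTrace n)

lemma x_eq {i j : ℕ} (hij : i ≤ j) (hj : j ≤ T.L) {u : Fin n}
    (h : ∀ t, i ≤ t → t < j → T.σ t ≠ u) : T.x i u = T.x j u := by
  induction j, hij using Nat.le_induction with
  | base => rfl
  | succ k hk ih =>
    rw [ih (by omega) fun t h1 h2 => h t h1 (by omega), T.step k (by omega),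
      Function.update_of_ne (h k hk (by omega)).symm]

lemma x_succ {t : ℕ} (ht : t < T.L) : T.x (t + 1) (T.σ t) = !(T.x t (T.σ t)) := by
  rw [T.step t ht, Function.update_self]

lemma x_ne {i j t : ℕ} (hit : i ≤ t) (htj : t < j) (hj : j ≤ T.L)
    (h : ∀ s, i ≤ s → s < j → s ≠ t → T.σ s ≠ T.σ t) : T.x i (T.σ t) ≠ T.x j (T.σ t) := by
  rw [T.x_eq hit (by omega) fun s h1 h2 => h s h1 (by omega) (by omega),
    ← T.x_eq (show t + 1 ≤ j by omega) hj fun s h1 h2 => h s (by omega) h2 (by omega), T.x_succ (by omega)]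
  simp

/-! ### Triangular systems of rows and the flips that determine them -/

/-- Whether the row of the pair of times `a` involves the edge between `p` and `q`. -/
def Involves (a : ℕ × ℕ) (p q : Fin n) : Prop :=
  (T.σ a.1 = p ∧ T.x a.1 q ≠ T.x a.2 q) ∨ (T.σ a.1 = q ∧ T.x a.1 p ≠ T.x a.2 p)

/-- The rows in `S` are in triangular form, the pivot of the row `a` being the edge between its
variable and `piv a`. -/
structure Triangular (S : Finset (ℕ × ℕ)) (piv : ℕ × ℕ → Fin n) : Prop where
  adj : ∀ a ∈ S, T.adj (T.σ a.1) (piv a)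
  ne : ∀ a ∈ S, T.x a.1 (piv a) ≠ T.x a.2 (piv a)
  exists_pivot : ∀ S' ⊆ S, S'.Nonempty → ∃ a ∈ S', ∀ b ∈ S', b ≠ a →
    ¬ T.Involves b (T.σ a.1) (piv a)

/-- The rows in `S` that belong to one variable are in triangular form along `key`. -/
structure Ordered (S : Finset (ℕ × ℕ)) (piv : ℕ × ℕ → Fin n) (key : ℕ × ℕ → ℤ) : Prop where
  adj : ∀ a ∈ S, T.adj (T.σ a.1) (piv a)
  ne : ∀ a ∈ S, T.x a.1 (piv a) ≠ T.x a.2 (piv a)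
  key_inj : ∀ a ∈ S, ∀ b ∈ S, T.σ a.1 = T.σ b.1 → key a = key b → a = b
  eq_of_key_lt : ∀ a ∈ S, ∀ b ∈ S, T.σ a.1 = T.σ b.1 → key a < key b →
    T.x b.1 (piv a) = T.x b.2 (piv a)

/-- The flips at the times in `E` suffice to reconstruct the rows in `S`. -/
structure Recorded (S : Finset (ℕ × ℕ)) (E : Finset ℕ) : Prop where
  subset : ∀ t ∈ E, t < T.L
  isArc : ∀ a ∈ S, IsArc T.σ a.1 a.2
  fst_mem : ∀ a ∈ S, a.1 ∈ E
  snd_mem : ∀ a ∈ S, a.2 ∈ E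
  first_mem : ∀ a ∈ S, ∀ t, a.1 < t → t < a.2 → T.adj (T.σ a.1) (T.σ t) →
    (∀ s, a.1 < s → s < t → T.σ s ≠ T.σ t) → t ∈ E
  last_mem : ∀ a ∈ S, ∀ t, a.1 < t → t < a.2 → T.adj (T.σ a.1) (T.σ t) →
    (∀ s, t < s → s < a.2 → T.σ s ≠ T.σ t) → t ∈ E

variable {T}

lemma Recorded.mono {S S' : Finset (ℕ × ℕ)} {E : Finset ℕ} (h : T.Recorded S E) (hS : S' ⊆ S) :
    T.Recorded S' E :=
  ⟨h.subset, fun a ha => h.isArc a (hS ha), fun a ha => h.fst_mem a (hS ha),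
    fun a ha => h.snd_mem a (hS ha), fun a ha => h.first_mem a (hS ha),
    fun a ha => h.last_mem a (hS ha)⟩

/-- The order within a variable extends to all variables when every pivot edge points to higher
rank. Take a variable of maximal rank and its row of least key: other rows of that variable are
excluded by the order, and a row of the variable at the other end of the pivot edge would have
higher rank. -/
lemma Ordered.triangular_filter {S : Finset (ℕ × ℕ)} {piv : ℕ × ℕ → Fin n} {key : ℕ × ℕ → ℤ}
    (h : T.Ordered S piv key) {S₁ : Finset (ℕ × ℕ)} (hS : S₁ ⊆ S) (rk : Fin n → ℤ)
    (hrk : ∀ a ∈ S₁, rk (T.σ a.1) < rk (piv a)) :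
    T.Triangular S₁ piv := by
  refine ⟨fun a ha => h.adj a (hS ha), fun a ha => h.ne a (hS ha), fun S' hS' hne => ?_⟩
  obtain ⟨a₀, ha₀, hmax⟩ := S'.exists_max_image (fun a => rk (T.σ a.1)) hne
  obtain ⟨a, ha, hmin⟩ := (S'.filter fun a => T.σ a.1 = T.σ a₀.1).exists_min_image key
    ⟨a₀, by simp [ha₀]⟩
  simp only [Finset.mem_filter] at ha hmin
  refine ⟨a, ha.1, fun b hb hba => ?_⟩
  rintro (⟨h1, h2⟩ | ⟨h1, h2⟩)
  · have hk := hmin b ⟨hb, h1.trans ha.2⟩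
    have hk' : key a ≠ key b := fun hc =>
      hba (h.key_inj a (hS (hS' ha.1)) b (hS (hS' hb)) h1.symm hc).symm
    exact h2 (h.eq_of_key_lt a (hS (hS' ha.1)) b (hS (hS' hb)) h1.symm (lt_of_le_of_ne hk hk'))
  · have h3 := hmax b hb
    have h4 := hrk a (hS' ha.1)
    rw [h1, ← ha.2] at h3
    omega

/-- Each pivot edge increases or decreases the index of the variable; the majority direction keeps
half of the rows, with rank the index or its negative. -/
lemma Ordered.exists_triangular {S : Finset (ℕ × ℕ)} {piv : ℕ × ℕ → Fin n} {key : ℕ × ℕ → ℤ}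
    (h : T.Ordered S piv key) : ∃ S₁ ⊆ S, S.card ≤ 2 * S₁.card ∧ T.Triangular S₁ piv := by
  have hsum := Finset.card_filter_add_card_filter_not (s := S) fun a => T.σ a.1 < piv a
  rcases le_total (S.filter fun a => ¬ T.σ a.1 < piv a).card (S.filter fun a => T.σ a.1 < piv a).card
    with hle | hle
  · refine ⟨_, Finset.filter_subset _ _, ?_, h.triangular_filter (Finset.filter_subset
      (fun a => T.σ a.1 < piv a) S) (fun v => (v : ℤ)) ?_⟩
    · omega
    · intro a ha
      simp only [Finset.mem_filter] at ha
      exact_mod_cast ha.2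
  · refine ⟨_, Finset.filter_subset _ _, ?_, h.triangular_filter (Finset.filter_subset
      (fun a => ¬ T.σ a.1 < piv a) S) (fun v => -(v : ℤ)) ?_⟩
    · omega
    · intro a ha
      simp only [Finset.mem_filter] at ha
      have h1 := T.adj_ne (h.adj a ha.1)
      have h2 : piv a < T.σ a.1 := lt_of_le_of_ne (not_lt.mp ha.2) h1.symm
      have : (piv a : ℕ) < T.σ a.1 := h2
      omega

/-- Rows of which no two belong to the same variable are ordered by any key. -/
lemma ordered_of_injOn {S : Finset (ℕ × ℕ)} (hS : ∀ a ∈ S, IsArc T.σ a.1 a.2 ∧ a.2 < T.L)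
    (hinj : ∀ a ∈ S, ∀ b ∈ S, T.σ a.1 = T.σ b.1 → a = b) :
    ∃ piv, T.Ordered S piv fun _ => 0 := by
  classical
  refine ⟨fun a => if h : IsArc T.σ a.1 a.2 ∧ a.2 < T.L then
    (T.exists_change _ _ h.1 h.2).choose else T.σ a.1, ?_, ?_, ?_, ?_⟩
  · intro a ha
    simp only [dif_pos (hS a ha)]
    exact (T.exists_change _ _ (hS a ha).1 (hS a ha).2).choose_spec.1
  · intro a ha
    simp only [dif_pos (hS a ha)]
    exact (T.exists_change _ _ (hS a ha).1 (hS a ha).2).choose_spec.2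
  · exact fun a ha b hb hab _ => hinj a ha b hb hab
  · intro a ha b hb _ h
    exact absurd h (lt_irrefl _)

/-- Recording all flips in an interval suffices to reconstruct all rows inside of it. -/
lemma recorded_interval {S : Finset (ℕ × ℕ)} {p q : ℕ}
    (hS : ∀ a ∈ S, IsArc T.σ a.1 a.2 ∧ a.2 < T.L ∧ p ≤ a.1 ∧ a.2 < q) :
    T.Recorded S ((Finset.Ico p q).filter (· < T.L)) := by
  constructor
  · intro t ht
    simp only [Finset.mem_filter] at ht
    exact ht.2
  · exact fun a ha => (hS a ha).1
  all_goals
    intro a ha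
    obtain ⟨h1, h2, h3, h4⟩ := hS a ha
    have := h1.lt
    simp only [Finset.mem_filter, Finset.mem_Ico]
  · omega
  · omega
  · intros; omega
  · intros; omega

end FlipTrace

/-! ### Double counting of windows over dyadic scales -/

/-- An item `b` occupies `[p b, q b]`, of length at most `2 ^ lo b`, and is counted at `D'` scales
`K`. At each of them it fits into at least half of the `2 ^ K` shifts of a window of length `2 ^ K`.
A window holds at most `2 ^ K / G` items and there are at most `2 * L` windows, so each of the `Rm`
scales contributes at most `4 * L / G`. -/
lemma card_le_of_windows {ι : Type*} (B : Finset ι) (p q lo : ι → ℕ) {D' G Rm L : ℕ}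
    (hpq : ∀ b ∈ B, p b ≤ q b ∧ q b ≤ p b + 2 ^ lo b ∧ q b < L) (hlo : ∀ b ∈ B, lo b + D' ≤ Rm)
    (hL : 2 ^ Rm ≤ L)
    (h : ∀ K a, G * (B.filter fun b => lo b < K ∧ K ≤ lo b + D' ∧ q b < a ∧ a ≤ p b + 2 ^ K).card
      ≤ 2 ^ K) :
    D' * (G * B.card) ≤ 4 * L * Rm := by
  classical
  have key : ∀ K ∈ Finset.Ioc 0 Rm,
      G * (B.filter fun b => lo b < K ∧ K ≤ lo b + D').card ≤ 4 * L := by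
    intro K hK
    rw [Finset.mem_Ioc] at hK
    have hKL : 2 ^ K ≤ L := (Nat.pow_le_pow_right (by norm_num) hK.2).trans hL
    set BK := B.filter fun b => lo b < K ∧ K ≤ lo b + D' with hBK
    have hdc := Finset.sum_card_bipartiteAbove_eq_sum_card_bipartiteBelow
      (s := Finset.range (L + 2 ^ K)) (t := BK) fun a b => q b < a ∧ a ≤ p b + 2 ^ K
    have h1 : ∀ b ∈ BK, 2 ^ (K - 1) ≤ ((Finset.range (L + 2 ^ K)).bipartiteBelow
        (fun a b => q b < a ∧ a ≤ p b + 2 ^ K) b).card := by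
      intro b hb
      rw [hBK, Finset.mem_filter] at hb
      obtain ⟨hb1, hb2, hb3⟩ := hb
      obtain ⟨hp1, hp2, hp3⟩ := hpq b hb1
      have : Finset.Ioc (q b) (p b + 2 ^ K) ⊆ (Finset.range (L + 2 ^ K)).bipartiteBelow
        (fun a b => q b < a ∧ a ≤ p b + 2 ^ K) b := by
        intro a ha
        simp only [Finset.mem_Ioc] at ha
        simp only [Finset.bipartiteBelow, Finset.mem_filter, Finset.mem_range]
        omega
      refine le_trans ?_ (Finset.card_le_card this)
      rw [Nat.card_Ioc]
      have h2 : 2 ^ lo b ≤ 2 ^ (K - 1) := Nat.pow_le_pow_right (by norm_num) (by omega)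
      have h3 : 2 ^ K = 2 * 2 ^ (K - 1) := by rw [← pow_succ', Nat.sub_add_cancel (by omega)]
      omega
    have h2 : ∀ a ∈ Finset.range (L + 2 ^ K), G * (BK.bipartiteAbove
        (fun a b => q b < a ∧ a ≤ p b + 2 ^ K) a).card ≤ 2 ^ K := by
      intro a _
      refine le_trans (Nat.mul_le_mul_left _ (Finset.card_le_card ?_)) (h K a)
      intro b hb
      simp only [Finset.bipartiteAbove, hBK, Finset.mem_filter] at hb ⊢
      tauto
    have h3 := Finset.sum_le_sum h1
    have h4 := Finset.sum_le_sum h2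
    rw [← Finset.mul_sum, hdc] at h4
    simp only [Finset.sum_const, smul_eq_mul, Finset.card_range] at h3 h4
    have h5 : 2 ^ K = 2 * 2 ^ (K - 1) := by rw [← pow_succ', Nat.sub_add_cancel (by omega)]
    have h6 : G * (BK.card * 2 ^ (K - 1)) ≤ (L + 2 ^ K) * 2 ^ K :=
      (Nat.mul_le_mul_left _ h3).trans h4
    have h7 : (G * BK.card) * 2 ^ (K - 1) ≤ (4 * L) * 2 ^ (K - 1) := by
      calc (G * BK.card) * 2 ^ (K - 1) ≤ (L + 2 ^ K) * (2 * 2 ^ (K - 1)) := by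
            rw [← h5]; linarith
        _ ≤ (L + L) * (2 * 2 ^ (K - 1)) := by gcongr
        _ = _ := by ring
    exact Nat.le_of_mul_le_mul_right h7 (by positivity)
  have hsum := Finset.sum_le_sum key
  rw [← Finset.mul_sum] at hsum
  have hdc := Finset.sum_card_bipartiteAbove_eq_sum_card_bipartiteBelow
      (s := Finset.Ioc 0 Rm) (t := B) fun K b => lo b < K ∧ K ≤ lo b + D'
  have h1 : ∀ b ∈ B, ((Finset.Ioc 0 Rm).bipartiteBelow
      (fun K b => lo b < K ∧ K ≤ lo b + D') b).card = D' := by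
    intro b hb
    have : (Finset.Ioc 0 Rm).bipartiteBelow (fun K b => lo b < K ∧ K ≤ lo b + D') b =
        Finset.Ioc (lo b) (lo b + D') := by
      ext K
      have := hlo b hb
      simp only [Finset.bipartiteBelow, Finset.mem_filter, Finset.mem_Ioc]
      omega
    rw [this, Nat.card_Ioc]; omega
  have h2 : ∑ K ∈ Finset.Ioc 0 Rm, (B.filter fun b => lo b < K ∧ K ≤ lo b + D').card
      = B.card * D' := by
    rw [← smul_eq_mul, ← Finset.sum_const, ← Finset.sum_congr rfl h1, ← hdc]
    rfl
  rw [h2] at hsum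
  simp only [Finset.sum_const, smul_eq_mul, Nat.card_Ioc, Nat.sub_zero] at hsum
  linarith

/-! ### Number and total length of arcs -/

namespace FlipTrace

variable {n : ℕ} (T : FlipTrace n)

open Classical in
/-- The arcs within the sequence. -/
noncomputable def arcs : Finset (ℕ × ℕ) :=
  (Finset.range T.L ×ˢ Finset.range T.L).filter fun a => IsArc T.σ a.1 a.2

variable {T}

lemma mem_arcs {a : ℕ × ℕ} : a ∈ T.arcs ↔ IsArc T.σ a.1 a.2 ∧ a.2 < T.L := by
  simp only [arcs, Finset.mem_filter, Finset.mem_product, Finset.mem_range]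
  constructor
  · tauto
  · rintro ⟨h1, h2⟩
    have := h1.lt
    exact ⟨⟨by omega, h2⟩, h1⟩

lemma arcs_fst_injOn : ∀ a ∈ T.arcs, ∀ b ∈ T.arcs, a.1 = b.1 → a = b := by
  intro a ha b hb h
  rw [mem_arcs] at ha hb
  refine Prod.ext h ((ha.1).snd_unique (h ▸ hb.1))

lemma arcs_snd_injOn : ∀ a ∈ T.arcs, ∀ b ∈ T.arcs, a.2 = b.2 → a = b := by
  intro a ha b hb h
  rw [mem_arcs] at ha hb
  refine Prod.ext ((ha.1).fst_unique (h ▸ hb.1)) h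

/-- Every flip except the first one of its variable closes an arc. -/
lemma le_card_arcs : T.L ≤ T.arcs.card + n := by
  classical
  have h1 : Finset.range T.L ⊆ T.arcs.image Prod.snd ∪
      (Finset.range T.L).filter fun t => ∀ s < t, T.σ s ≠ T.σ t := by
    intro t ht
    rw [Finset.mem_union]
    by_cases h : ∀ s < t, T.σ s ≠ T.σ t
    · right; simp only [Finset.mem_filter]; exact ⟨ht, h⟩
    · left
      push Not at h
      obtain ⟨s, hs, he⟩ := h
      obtain ⟨r, -, hr⟩ := exists_isArc_left hs he
      rw [Finset.mem_image]
      exact ⟨(r, t), mem_arcs.mpr ⟨hr, Finset.mem_range.mp ht⟩, rfl⟩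
  have h2 : ((Finset.range T.L).filter fun t => ∀ s < t, T.σ s ≠ T.σ t).card ≤ n := by
    have := Finset.card_le_card_of_injOn (s := (Finset.range T.L).filter
      fun t => ∀ s < t, T.σ s ≠ T.σ t) (t := Finset.univ) T.σ (fun _ _ => Finset.mem_univ _) (by
        intro a ha b hb hab
        simp only [Finset.coe_filter, Set.mem_ofPred_eq] at ha hb
        by_contra hc
        rcases lt_or_gt_of_ne hc with hlt | hlt
        · exact hb.2 a hlt hab
        · exact ha.2 b hlt hab.symm)
    simpa using this
  have h3 := Finset.card_le_card h1
  have h4 := Finset.card_union_le (T.arcs.image Prod.snd)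
    ((Finset.range T.L).filter fun t => ∀ s < t, T.σ s ≠ T.σ t)
  have h5 : (T.arcs.image Prod.snd).card ≤ T.arcs.card := Finset.card_image_le
  rw [Finset.card_range] at h3
  omega

/-- Arcs that cross the same cut belong to different variables. -/
lemma eq_of_crossing {a b : ℕ × ℕ} {c : ℕ} (ha : IsArc T.σ a.1 a.2) (hb : IsArc T.σ b.1 b.2)
    (ha1 : a.1 < c) (ha2 : c ≤ a.2) (hb1 : b.1 < c) (hb2 : c ≤ b.2)
    (hab : T.σ a.1 = T.σ b.1) : a = b := by
  have h1 := ha.le_of_lt' (t := b.1) (by omega) hab.symm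
  have h2 := hb.le_of_lt' (t := a.1) (by omega) hab
  have h3 : a.1 = b.1 := by omega
  exact Prod.ext h3 (ha.snd_unique (h3 ▸ hb))

lemma sum_crossing {B : Finset (ℕ × ℕ)} (hB : B ⊆ T.arcs) :
    ∑ c ∈ Finset.range T.L, (B.filter fun a => a.1 < c ∧ c ≤ a.2).card
      = ∑ a ∈ B, (a.2 - a.1) := by
  have hdc := Finset.sum_card_bipartiteAbove_eq_sum_card_bipartiteBelow
      (s := Finset.range T.L) (t := B) fun c a => a.1 < c ∧ c ≤ a.2
  simp only [Finset.bipartiteAbove, Finset.bipartiteBelow] at hdc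
  rw [hdc]
  refine Finset.sum_congr rfl fun a ha => ?_
  have h := mem_arcs.mp (hB ha)
  rw [← Nat.card_Ioc]
  congr 1
  ext c
  simp only [Finset.mem_filter, Finset.mem_range, Finset.mem_Ioc]
  omega

lemma sum_length_arcs_le : ∑ a ∈ T.arcs, (a.2 - a.1) ≤ n * T.L := by
  rw [← sum_crossing (Finset.Subset.refl _)]
  refine (Finset.sum_le_card_nsmul _ _ n fun c _ => ?_).trans ?_
  · have := Finset.card_le_card_of_injOn (s := T.arcs.filter fun a => a.1 < c ∧ c ≤ a.2)
      (t := Finset.univ) (fun a => T.σ a.1) (fun _ _ => Finset.mem_univ _) (by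
        intro a ha b hb hab
        simp only [Finset.coe_filter, Set.mem_ofPred_eq, mem_arcs] at ha hb
        exact eq_of_crossing ha.1.1 hb.1.1 ha.2.1 ha.2.2 hb.2.1 hb.2.2 hab)
    simpa using this
  · rw [Finset.card_range, smul_eq_mul, mul_comm]

/-- At most `n` arcs cross a cut, so the total length is at most `n * T.L`, and arcs of length at
least `4 * n` are at most a quarter of `T.L`. -/
lemma half_le_card_short {R : ℕ} (hR : 4 * n ≤ 2 ^ R) (hL : 4 * n ≤ T.L) :
    T.L ≤ 2 * (T.arcs.filter fun a => a.2 - a.1 < 2 ^ R).card := by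
  have h1 := Finset.card_filter_add_card_filter_not (s := T.arcs) fun a => a.2 - a.1 < 2 ^ R
  have h2 : (T.arcs.filter fun a => ¬ a.2 - a.1 < 2 ^ R).card * 2 ^ R ≤ n * T.L := by
    have h2 : ∀ a ∈ T.arcs.filter fun a => ¬ a.2 - a.1 < 2 ^ R, 2 ^ R ≤ a.2 - a.1 := by
      intro a ha
      simp only [Finset.mem_filter, not_lt] at ha
      exact ha.2
    calc _ = ∑ a ∈ T.arcs.filter fun a => ¬ a.2 - a.1 < 2 ^ R, 2 ^ R := by
          rw [Finset.sum_const, smul_eq_mul]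
      _ ≤ ∑ a ∈ T.arcs.filter fun a => ¬ a.2 - a.1 < 2 ^ R, (a.2 - a.1) := Finset.sum_le_sum h2
      _ ≤ ∑ a ∈ T.arcs, (a.2 - a.1) := Finset.sum_le_sum_of_subset (Finset.filter_subset _ _)
      _ ≤ _ := sum_length_arcs_le
  have h3 := T.le_card_arcs
  set x := (T.arcs.filter fun a => ¬ a.2 - a.1 < 2 ^ R).card
  have h4 : x * (4 * n) ≤ n * T.L := (Nat.mul_le_mul_left _ hR).trans h2
  rcases Nat.eq_zero_or_pos n with rfl | hn
  · have : T.L = 0 := by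
      by_contra hc
      exact (T.σ 0).elim0
    omega
  · have h5 : 4 * x ≤ T.L := Nat.le_of_mul_le_mul_left (by linarith) hn
    omega

end FlipTrace

/-! ### Atypical arcs are rare if rows are expensive -/

namespace FlipTrace

variable {n : ℕ} (T : FlipTrace n)

/-- Reconstructing an ordered set of rows always takes more than `G` flips per row. -/
def Expensive (G : ℕ) : Prop :=
  ∀ (S : Finset (ℕ × ℕ)) (E : Finset ℕ) (piv : ℕ × ℕ → Fin n) (key : ℕ × ℕ → ℤ), S.Nonempty →
    T.Ordered S piv key → T.Recorded S E → G * S.card < E.card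

/-- The scale of an arc: the binary logarithm of its length. -/
def scale (a : ℕ × ℕ) : ℕ := Nat.log 2 (a.2 - a.1)

/-- The variable flipped at time `t` is not flipped in the preceding `H - 1` steps. -/
def QuietLeft (t H : ℕ) : Prop := ∀ s < t, t < s + H → T.σ s ≠ T.σ t

/-- The variable flipped at time `t` is not flipped in the following `H - 1` steps. -/
def QuietRight (t H : ℕ) : Prop := ∀ s, t < s → s < t + H → s < T.L → T.σ s ≠ T.σ t

open Classical in
/-- The arcs of length less than `2 ^ R` preceded by a much shorter arc. -/
noncomputable def shortBefore (R D : ℕ) : Finset (ℕ × ℕ) :=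
  T.arcs.filter fun a => a.2 - a.1 < 2 ^ R ∧ ¬ T.QuietLeft a.1 (2 ^ (scale a - D))

open Classical in
/-- The arcs of length less than `2 ^ R` followed by a much shorter arc. -/
noncomputable def shortAfter (R D : ℕ) : Finset (ℕ × ℕ) :=
  T.arcs.filter fun a => a.2 - a.1 < 2 ^ R ∧ ¬ T.QuietRight a.2 (2 ^ (scale a - D))

/-- The arc `a` contains a flip of a neighbour that is isolated within `2 ^ (scale a + D)` steps. -/
def HasIsolated (D : ℕ) (a : ℕ × ℕ) : Prop :=
  ∃ t, a.1 < t ∧ t < a.2 ∧ T.adj (T.σ a.1) (T.σ t) ∧ T.QuietLeft t (2 ^ (scale a + D)) ∧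
    T.QuietRight t (2 ^ (scale a + D))

open Classical in
/-- The arcs of length less than `2 ^ R` that contain an isolated flip of a neighbour. -/
noncomputable def withIsolated (R D : ℕ) : Finset (ℕ × ℕ) :=
  T.arcs.filter fun a => a.2 - a.1 < 2 ^ R ∧ T.HasIsolated D a

variable {T} {R D G : ℕ}

lemma pow_scale_le {a : ℕ × ℕ} (h : a.1 < a.2) : 2 ^ scale a ≤ a.2 - a.1 :=
  Nat.pow_log_le_self 2 (by omega)

lemma lt_pow_scale {a : ℕ × ℕ} : a.2 - a.1 < 2 ^ (scale a + 1) :=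
  Nat.lt_pow_succ_log_self (by norm_num) _

lemma scale_lt {a : ℕ × ℕ} (h : a.1 < a.2) (hR : a.2 - a.1 < 2 ^ R) : scale a < R :=
  Nat.log_lt_of_lt_pow (by omega) hR

/-- Recording the entire window reconstructs every row inside it, so the window length bounds the
price of the rows. -/
lemma Expensive.le_of_window (hG : T.Expensive G) {S : Finset (ℕ × ℕ)} {piv : ℕ × ℕ → Fin n}
    {key : ℕ × ℕ → ℤ} (hS : T.Ordered S piv key) {p q : ℕ}
    (h : ∀ a ∈ S, IsArc T.σ a.1 a.2 ∧ a.2 < T.L ∧ p ≤ a.1 ∧ a.2 < q) : G * S.card ≤ q - p := by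
  rcases S.eq_empty_or_nonempty with rfl | hne
  · simp
  · refine (hG S _ piv key hne hS (recorded_interval h)).le.trans ?_
    exact (Finset.card_filter_le _ _).trans (Nat.card_Ico _ _).le

lemma Expensive.le_of_window_of_injOn (hG : T.Expensive G) {S : Finset (ℕ × ℕ)} {p q : ℕ}
    (h : ∀ a ∈ S, IsArc T.σ a.1 a.2 ∧ a.2 < T.L ∧ p ≤ a.1 ∧ a.2 < q)
    (hinj : ∀ a ∈ S, ∀ b ∈ S, T.σ a.1 = T.σ b.1 → a = b) : G * S.card ≤ q - p := by
  obtain ⟨piv, hp⟩ := ordered_of_injOn (fun a ha => ⟨(h a ha).1, (h a ha).2.1⟩) hinj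
  exact hG.le_of_window hp h

lemma exists_before {a : ℕ × ℕ} {H : ℕ} (h : ¬ T.QuietLeft a.1 H) :
    ∃ i, IsArc T.σ i a.1 ∧ a.1 < i + H := by
  simp only [QuietLeft] at h
  push Not at h
  obtain ⟨s, h1, h2, h3⟩ := h
  obtain ⟨r, h4, h5⟩ := exists_isArc_left h1 h3
  exact ⟨r, h5, by omega⟩

lemma exists_after {a : ℕ × ℕ} {H : ℕ} (h : ¬ T.QuietRight a.2 H) :
    ∃ i, IsArc T.σ a.2 i ∧ i < a.2 + H ∧ i < T.L := by
  simp only [QuietRight] at h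
  push Not at h
  obtain ⟨s, h1, h2, h3, h4⟩ := h
  obtain ⟨r, h5, h6⟩ := exists_isArc_right h1 h4.symm
  exact ⟨r, h6, by omega, by omega⟩

/-- The rows are the short arcs preceding the arcs `a`. At scales up to that of `a`, the long arc
that follows keeps a variable from contributing two of them to one window, so no order within a
variable is needed. -/
lemma Expensive.card_shortBefore_le (hG : T.Expensive G) (hL : 2 ^ R ≤ T.L) :
    D * (G * (T.shortBefore R D).card) ≤ 4 * T.L * R := by
  classical
  have hex : ∀ a : ℕ × ℕ, ∃ i, a ∈ T.shortBefore R D →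
      IsArc T.σ i a.1 ∧ a.1 < i + 2 ^ (scale a - D) := by
    intro a
    by_cases ha : a ∈ T.shortBefore R D
    · simp only [shortBefore, Finset.mem_filter] at ha
      obtain ⟨i, hi⟩ := exists_before ha.2.2
      exact ⟨i, fun _ => hi⟩
    · exact ⟨0, fun h => absurd h ha⟩
  choose p hp using hex
  have hmem : ∀ a ∈ T.shortBefore R D, IsArc T.σ a.1 a.2 ∧ a.2 < T.L ∧ scale a < R ∧
      D ≤ scale a := by
    intro a ha
    obtain ⟨h1, h2⟩ := hp a ha
    simp only [shortBefore, Finset.mem_filter, mem_arcs] at ha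
    refine ⟨ha.1.1, ha.1.2, scale_lt ha.1.1.lt ha.2.1, ?_⟩
    -- Below scale `D` the truncated exponent is `0`, and a preceding arc of length less than `1`
    -- does not exist.
    by_contra hc
    rw [show scale a - D = 0 by omega] at h2
    have := h1.lt
    omega
  refine card_le_of_windows (T.shortBefore R D) p (fun a => a.1) (fun a => scale a - D) ?_ ?_ hL ?_
  · intro a ha
    have h1 := hp a ha
    have h2 := hmem a ha
    have := h1.1.lt
    have := h2.1.lt
    omega
  · intro a ha
    have h2 := hmem a ha
    omega
  · intro K c
    set F := (T.shortBefore R D).filter fun b => scale b - D < K ∧ K ≤ scale b - D + D ∧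
      b.1 < c ∧ c ≤ p b + 2 ^ K with hF
    have hcard : (F.image fun a => (p a, a.1)).card = F.card := by
      refine Finset.card_image_of_injOn fun a ha b hb hab => ?_
      simp only [hF, Finset.coe_filter, Set.mem_ofPred_eq] at ha hb
      have h1 := hmem a ha.1
      have h2 := hmem b hb.1
      exact arcs_fst_injOn a (mem_arcs.mpr ⟨h1.1, h1.2.1⟩) b (mem_arcs.mpr ⟨h2.1, h2.2.1⟩)
        (Prod.ext_iff.mp hab).2
    have h0 : c - (c - 2 ^ K) ≤ 2 ^ K := tsub_tsub_le
    refine le_trans ?_ h0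
    rw [← hcard]
    refine hG.le_of_window_of_injOn ?_ ?_
    · intro a ha
      simp only [hF, Finset.mem_image, Finset.mem_filter] at ha
      obtain ⟨b, ⟨hb, h1, h2, h3, h4⟩, rfl⟩ := ha
      have h5 := hmem b hb
      have h6 := h5.1.lt
      exact ⟨(hp b hb).1, by dsimp only; omega, by dsimp only; omega, h3⟩
    · intro a ha a' ha'
      simp only [hF, Finset.mem_image, Finset.mem_filter] at ha ha'
      obtain ⟨b, ⟨hb, h1, h2, h3, h4⟩, rfl⟩ := ha
      obtain ⟨b', ⟨hb', h1', h2', h3', h4'⟩, rfl⟩ := ha'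
      intro hs
      dsimp only at hs
      rw [(hp b hb).1.eq, (hp b' hb').1.eq] at hs
      have hm := hmem b hb
      have hm' := hmem b' hb'
      have hl := (hp b hb).1.lt
      have hl' := (hp b' hb').1.lt
      have hk : 2 ^ K ≤ b.2 - b.1 := (Nat.pow_le_pow_right (by norm_num) (by omega)).trans
        (pow_scale_le hm.1.lt)
      have hk' : 2 ^ K ≤ b'.2 - b'.1 := (Nat.pow_le_pow_right (by norm_num) (by omega)).trans
        (pow_scale_le hm'.1.lt)
      have : b.1 = b'.1 := by
        rcases lt_trichotomy b.1 b'.1 with h | h | h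
        · have := hm.1.le_of_lt h hs.symm
          omega
        · exact h
        · have := hm'.1.le_of_lt h hs
          omega
      rw [arcs_fst_injOn b (mem_arcs.mpr ⟨hm.1, hm.2.1⟩) b' (mem_arcs.mpr ⟨hm'.1, hm'.2.1⟩) this]

lemma Expensive.card_shortAfter_le (hG : T.Expensive G) (hL : 2 ^ R ≤ T.L) :
    D * (G * (T.shortAfter R D).card) ≤ 4 * T.L * R := by
  classical
  have hex : ∀ a : ℕ × ℕ, ∃ i, a ∈ T.shortAfter R D →
      IsArc T.σ a.2 i ∧ i < a.2 + 2 ^ (scale a - D) ∧ i < T.L := by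
    intro a
    by_cases ha : a ∈ T.shortAfter R D
    · simp only [shortAfter, Finset.mem_filter] at ha
      obtain ⟨i, hi⟩ := exists_after ha.2.2
      exact ⟨i, fun _ => hi⟩
    · exact ⟨0, fun h => absurd h ha⟩
  choose p hp using hex
  have hmem : ∀ a ∈ T.shortAfter R D, IsArc T.σ a.1 a.2 ∧ a.2 < T.L ∧ scale a < R ∧
      D ≤ scale a := by
    intro a ha
    obtain ⟨h1, h2, h3⟩ := hp a ha
    simp only [shortAfter, Finset.mem_filter, mem_arcs] at ha
    refine ⟨ha.1.1, ha.1.2, scale_lt ha.1.1.lt ha.2.1, ?_⟩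
    by_contra hc
    rw [show scale a - D = 0 by omega] at h2
    have := h1.lt
    omega
  refine card_le_of_windows (T.shortAfter R D) (fun a => a.2) p (fun a => scale a - D) ?_ ?_ hL ?_
  · intro a ha
    have h1 := hp a ha
    have h2 := hmem a ha
    have := h1.1.lt
    have := h2.1.lt
    omega
  · intro a ha
    have h2 := hmem a ha
    omega
  · intro K c
    set F := (T.shortAfter R D).filter fun b => scale b - D < K ∧ K ≤ scale b - D + D ∧
      p b < c ∧ c ≤ b.2 + 2 ^ K with hF
    have hcard : (F.image fun a => (a.2, p a)).card = F.card := by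
      refine Finset.card_image_of_injOn fun a ha b hb hab => ?_
      simp only [hF, Finset.coe_filter, Set.mem_ofPred_eq] at ha hb
      have h1 := hmem a ha.1
      have h2 := hmem b hb.1
      exact arcs_snd_injOn a (mem_arcs.mpr ⟨h1.1, h1.2.1⟩) b (mem_arcs.mpr ⟨h2.1, h2.2.1⟩)
        (Prod.ext_iff.mp hab).1
    have h0 : c - (c - 2 ^ K) ≤ 2 ^ K := tsub_tsub_le
    refine le_trans ?_ h0
    rw [← hcard]
    refine hG.le_of_window_of_injOn ?_ ?_
    · intro a ha
      simp only [hF, Finset.mem_image, Finset.mem_filter] at ha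
      obtain ⟨b, ⟨hb, h1, h2, h3, h4⟩, rfl⟩ := ha
      have h5 := hmem b hb
      have h6 := h5.1.lt
      exact ⟨(hp b hb).1, (hp b hb).2.2, by dsimp only; omega, h3⟩
    · intro a ha a' ha'
      simp only [hF, Finset.mem_image, Finset.mem_filter] at ha ha'
      obtain ⟨b, ⟨hb, h1, h2, h3, h4⟩, rfl⟩ := ha
      obtain ⟨b', ⟨hb', h1', h2', h3', h4'⟩, rfl⟩ := ha'
      intro hs
      dsimp only at hs
      have hm := hmem b hb
      have hm' := hmem b' hb'
      have hl := (hp b hb).1.lt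
      have hl' := (hp b' hb').1.lt
      have hk : 2 ^ K ≤ b.2 - b.1 := (Nat.pow_le_pow_right (by norm_num) (by omega)).trans
        (pow_scale_le hm.1.lt)
      have hk' : 2 ^ K ≤ b'.2 - b'.1 := (Nat.pow_le_pow_right (by norm_num) (by omega)).trans
        (pow_scale_le hm'.1.lt)
      have : b.2 = b'.2 := by
        rcases lt_trichotomy b.2 b'.2 with h | h | h
        · have := hm'.1.le_of_lt' h (hs.trans hm'.1.eq.symm)
          omega
        · exact h
        · have := hm.1.le_of_lt' h (hs.symm.trans hm.1.eq.symm)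
          omega
      rw [arcs_snd_injOn b (mem_arcs.mpr ⟨hm.1, hm.2.1⟩) b' (mem_arcs.mpr ⟨hm'.1, hm'.2.1⟩) this]

/-- The isolated neighbour is the pivot. Within a window shorter than its quiet period it flips
once, so it does not change in any later arc of the same variable; ordering by right ends works. -/
lemma Expensive.card_withIsolated_le (hG : T.Expensive G) (hD : 1 ≤ D) (hL : 2 ^ (R + D) ≤ T.L) :
    (D - 1) * (G * (T.withIsolated R D).card) ≤ 4 * T.L * (R + D) := by
  classical
  have hex : ∀ a : ℕ × ℕ, ∃ t, a ∈ T.withIsolated R D →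
      a.1 < t ∧ t < a.2 ∧ T.adj (T.σ a.1) (T.σ t) ∧ T.QuietLeft t (2 ^ (scale a + D)) ∧
        T.QuietRight t (2 ^ (scale a + D)) := by
    intro a
    by_cases ha : a ∈ T.withIsolated R D
    · simp only [withIsolated, Finset.mem_filter] at ha
      obtain ⟨t, ht⟩ := ha.2.2
      exact ⟨t, fun _ => ht⟩
    · exact ⟨0, fun h => absurd h ha⟩
  choose p hp using hex
  have hmem : ∀ a ∈ T.withIsolated R D, IsArc T.σ a.1 a.2 ∧ a.2 < T.L ∧ scale a < R := by
    intro a ha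
    simp only [withIsolated, Finset.mem_filter, mem_arcs] at ha
    exact ⟨ha.1.1, ha.1.2, scale_lt ha.1.1.lt ha.2.1⟩
  -- The item is the arc itself, whose length is only bounded by `2 ^ (scale a + 1)`; this costs one
  -- of the `D` scales.
  refine card_le_of_windows (T.withIsolated R D) (fun a => a.1) (fun a => a.2)
    (fun a => scale a + 1) ?_ ?_ hL ?_
  · intro a ha
    have h2 := hmem a ha
    have := h2.1.lt
    have := lt_pow_scale (a := a)
    omega
  · intro a ha
    have h2 := hmem a ha
    omega
  · intro K c
    set F := (T.withIsolated R D).filter fun b => scale b + 1 < K ∧ K ≤ scale b + 1 + (D - 1) ∧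
      b.2 < c ∧ c ≤ b.1 + 2 ^ K with hF
    have h0 : c - (c - 2 ^ K) ≤ 2 ^ K := tsub_tsub_le
    refine le_trans ?_ h0
    have hFmem : ∀ a ∈ F, a ∈ T.withIsolated R D ∧ 2 ^ K ≤ 2 ^ (scale a + D) ∧
        a.2 < c ∧ c ≤ a.1 + 2 ^ K := by
      intro a ha
      simp only [hF, Finset.mem_filter] at ha
      exact ⟨ha.1, Nat.pow_le_pow_right (by norm_num) (by omega), ha.2.2.2⟩
    refine hG.le_of_window (piv := fun a => T.σ (p a)) (key := fun a => a.2) ⟨?_, ?_, ?_, ?_⟩ ?_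
    · intro a ha
      exact (hp a (hFmem a ha).1).2.2.1
    · intro a ha
      obtain ⟨h1, h2, h3, h4⟩ := hFmem a ha
      obtain ⟨h5, h6, h7, h8, h9⟩ := hp a h1
      have h10 := hmem a h1
      refine T.x_ne h5.le h6 (by omega) fun s hs1 hs2 hs3 => ?_
      rcases lt_or_gt_of_ne hs3 with h | h
      · exact h8 s h (by omega)
      · exact h9 s h (by omega) (by omega)
    · intro a ha b hb _ hab
      have h1 := hmem a (hFmem a ha).1
      have h2 := hmem b (hFmem b hb).1
      exact arcs_snd_injOn a (mem_arcs.mpr ⟨h1.1, h1.2.1⟩) b (mem_arcs.mpr ⟨h2.1, h2.2.1⟩)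
        (by exact_mod_cast hab)
    · intro a ha b hb hab hlt
      have hlt : a.2 < b.2 := by exact_mod_cast hlt
      obtain ⟨h1, h2, h3, h4⟩ := hFmem a ha
      obtain ⟨h5, h6, h7, h8, h9⟩ := hp a h1
      obtain ⟨g1, g2, g3, g4⟩ := hFmem b hb
      have h10 := hmem a h1
      have g10 := hmem b g1
      have := g10.1.lt
      have hle := g10.1.le_of_lt' hlt (h10.1.eq.symm.trans hab)
      exact T.x_eq g10.1.lt.le (by omega) fun s hs1 hs2 => h9 s (by omega) (by omega) (by omega)
    · intro a ha
      obtain ⟨h1, h2, h3, h4⟩ := hFmem a ha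
      have h10 := hmem a h1
      exact ⟨h10.1, h10.2.1, by omega, h3⟩

end FlipTrace

/-! ### Balanced arcs of one scale crossing a cut -/

namespace FlipTrace

variable {n : ℕ} (T : FlipTrace n) {R D G k c : ℕ}

/-- The arcs of length at least `2 ^ (k - D)` and less than `2 ^ (k + D)`. -/
noncomputable def midArcs (D k : ℕ) : Finset (ℕ × ℕ) :=
  T.arcs.filter fun a => 2 ^ (k - D) ≤ a.2 - a.1 ∧ a.2 - a.1 < 2 ^ (k + D)

open Classical in
/-- The endpoints near `c` of the arcs in `midArcs`. -/
noncomputable def midEnds (D k c : ℕ) : Finset ℕ :=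
  ((T.midArcs D k).image Prod.fst ∪ (T.midArcs D k).image Prod.snd).filter
    fun t => c ≤ t + 2 ^ (k + 1) ∧ t < c + 2 ^ (k + 1)

open Classical in
/-- Short arcs that end near `c` and are followed by a long quiet period. -/
noncomputable def clusterEnds (D k c : ℕ) : Finset (ℕ × ℕ) :=
  T.arcs.filter fun a => a.2 - a.1 < 2 ^ (k - D) ∧ T.QuietRight a.2 (2 ^ (k + D)) ∧
    c ≤ a.2 + 2 ^ (k + 1) ∧ a.2 < c + 2 ^ (k + 1)

open Classical in
/-- Short arcs that start near `c` and are preceded by a long quiet period. -/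
noncomputable def clusterStarts (D k c : ℕ) : Finset (ℕ × ℕ) :=
  T.arcs.filter fun a => a.2 - a.1 < 2 ^ (k - D) ∧ T.QuietLeft a.1 (2 ^ (k + D)) ∧
    c ≤ a.1 + 2 ^ (k + 1) ∧ a.1 < c + 2 ^ (k + 1)

open Classical in
/-- Short arcs before `c` that contain the start of an arc in `P` of a neighbour. -/
noncomputable def shortAtStart (P : Finset (ℕ × ℕ)) (D k c : ℕ) : Finset (ℕ × ℕ) :=
  T.arcs.filter fun a => a.2 - a.1 < 2 ^ (k - D) ∧ a.2 < c ∧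
    ∃ b ∈ P, T.adj (T.σ a.1) (T.σ b.1) ∧ a.1 < b.1 ∧ b.1 < a.2

open Classical in
/-- Short arcs after `c` that contain the end of an arc in `P` of a neighbour. -/
noncomputable def shortAtEnd (P : Finset (ℕ × ℕ)) (D k c : ℕ) : Finset (ℕ × ℕ) :=
  T.arcs.filter fun a => a.2 - a.1 < 2 ^ (k - D) ∧ c ≤ a.1 ∧
    ∃ b ∈ P, T.adj (T.σ a.1) (T.σ b.1) ∧ a.1 < b.2 ∧ b.2 < a.2

/-- Arcs of scale `k` crossing the cut `c` that have no much shorter neighbouring arcs and contain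
no isolated flip of a neighbour. -/
def IsBalancedCut (P : Finset (ℕ × ℕ)) (D k c : ℕ) : Prop :=
  ∀ a ∈ P, (IsArc T.σ a.1 a.2 ∧ a.2 < T.L) ∧ scale a = k ∧ a.1 < c ∧ c ≤ a.2 ∧
    T.QuietLeft a.1 (2 ^ (k - D)) ∧ T.QuietRight a.2 (2 ^ (k - D)) ∧ ¬ T.HasIsolated D a

variable {T}

lemma two_pow_sub_le : 2 ^ (k - D) ≤ 2 ^ k := Nat.pow_le_pow_right (by norm_num) (by omega)

/-- This window contains all arcs of the four auxiliary families: one end is within `2 ^ (k + 1)` of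
`c`, and the length is below `2 ^ (k - D)`. -/
lemma window_le : (c + 2 ^ (k + 1) + 2 ^ (k - D)) - (c - (2 ^ (k + 1) + 2 ^ (k - D))) ≤ 2 ^ (k + 3) := by
  have h1 : 2 ^ (k - D) ≤ 2 ^ k := two_pow_sub_le
  have h2 : 2 ^ (k + 1) = 2 * 2 ^ k := by ring
  have h3 : 2 ^ (k + 3) = 8 * 2 ^ k := by ring
  rw [h2, h3]
  generalize 2 ^ (k - D) = h at *
  generalize 2 ^ k = m at *
  omega

/-- All right ends lie in a range of length `4 * 2 ^ k`, which the quiet period covers because `2 ≤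
D`; hence one arc per variable. -/
lemma Expensive.card_clusterEnds_le (hG : T.Expensive G) (hD : 2 ≤ D) :
    G * (T.clusterEnds D k c).card ≤ 2 ^ (k + 3) := by
  refine le_trans ?_ (window_le (c := c) (k := k) (D := D))
  refine hG.le_of_window_of_injOn ?_ ?_
  · intro a ha
    simp only [clusterEnds, Finset.mem_filter, mem_arcs] at ha
    have := ha.1.1.lt
    generalize 2 ^ (k - D) = h at *
    generalize 2 ^ (k + 1) = m at *
    refine ⟨ha.1.1, ha.1.2, ?_, ?_⟩ <;> omega
  · intro a ha b hb hab
    simp only [clusterEnds, Finset.mem_filter] at ha hb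
    have h1 : 4 * 2 ^ k ≤ 2 ^ (k + D) := by
      rw [show 4 * 2 ^ k = 2 ^ (k + 2) by ring]
      exact Nat.pow_le_pow_right (by norm_num) (by omega)
    have h2 : 2 ^ (k + 1) = 2 * 2 ^ k := by ring
    rw [h2] at ha hb
    have ea := (mem_arcs.mp ha.1)
    have eb := (mem_arcs.mp hb.1)
    have e : T.σ a.2 = T.σ b.2 := by rw [← ea.1.eq, hab, eb.1.eq]
    refine arcs_snd_injOn a ha.1 b hb.1 ?_
    rcases lt_trichotomy a.2 b.2 with h | h | h
    · exact absurd e.symm (ha.2.2.1 b.2 h (by omega) eb.2)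
    · exact h
    · exact absurd e (hb.2.2.1 a.2 h (by omega) ea.2)

lemma Expensive.card_clusterStarts_le (hG : T.Expensive G) (hD : 2 ≤ D) :
    G * (T.clusterStarts D k c).card ≤ 2 ^ (k + 3) := by
  refine le_trans ?_ (window_le (c := c) (k := k) (D := D))
  refine hG.le_of_window_of_injOn ?_ ?_
  · intro a ha
    simp only [clusterStarts, Finset.mem_filter, mem_arcs] at ha
    have := ha.1.1.lt
    generalize 2 ^ (k - D) = h at *
    generalize 2 ^ (k + 1) = m at *
    refine ⟨ha.1.1, ha.1.2, ?_, ?_⟩ <;> omega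
  · intro a ha b hb hab
    simp only [clusterStarts, Finset.mem_filter] at ha hb
    have h1 : 4 * 2 ^ k ≤ 2 ^ (k + D) := by
      rw [show 4 * 2 ^ k = 2 ^ (k + 2) by ring]
      exact Nat.pow_le_pow_right (by norm_num) (by omega)
    have h2 : 2 ^ (k + 1) = 2 * 2 ^ k := by ring
    rw [h2] at ha hb
    refine arcs_fst_injOn a ha.1 b hb.1 ?_
    rcases lt_trichotomy a.1 b.1 with h | h | h
    · exact absurd hab (hb.2.2.1 a.1 h (by omega))
    · exact h
    · exact absurd hab.symm (ha.2.2.1 b.1 h (by omega))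

lemma IsBalancedCut.lt {P : Finset (ℕ × ℕ)} (hP : T.IsBalancedCut P D k c) {a : ℕ × ℕ}
    (ha : a ∈ P) : a.2 < a.1 + 2 * 2 ^ k := by
  have h := lt_pow_scale (a := a)
  rw [(hP a ha).2.1, show 2 ^ (k + 1) = 2 * 2 ^ k by ring] at h
  have := (hP a ha).1.1.lt
  omega

/-- The pivot is the neighbour whose arc in `P` starts inside the short arc. It flips just once
there: the preceding quiet period exceeds the length of the short arc, and its next flip is not
before the cut. The latter also keeps it fixed during later arcs before `c`, so right ends serve as
keys. -/
lemma Expensive.card_shortAtStart_le (hG : T.Expensive G) {P : Finset (ℕ × ℕ)}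
    (hP : T.IsBalancedCut P D k c) : G * (T.shortAtStart P D k c).card ≤ 2 ^ (k + 3) := by
  classical
  refine le_trans ?_ (window_le (c := c) (k := k) (D := D))
  have hex : ∀ a : ℕ × ℕ, ∃ b, a ∈ T.shortAtStart P D k c →
      b ∈ P ∧ T.adj (T.σ a.1) (T.σ b.1) ∧ a.1 < b.1 ∧ b.1 < a.2 := by
    intro a
    by_cases ha : a ∈ T.shortAtStart P D k c
    · simp only [shortAtStart, Finset.mem_filter] at ha
      obtain ⟨b, hb⟩ := ha.2.2.2
      exact ⟨b, fun _ => hb⟩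
    · exact ⟨0, fun h => absurd h ha⟩
  choose p hp using hex
  refine hG.le_of_window (piv := fun a => T.σ (p a).1) (key := fun a => a.2) ⟨?_, ?_, ?_, ?_⟩ ?_
  · exact fun a ha => (hp a ha).2.1
  · intro a ha
    obtain ⟨h1, h2, h3, h4⟩ := hp a ha
    obtain ⟨h5, h6, h7, h8, h9, h10, h11⟩ := hP _ h1
    simp only [shortAtStart, Finset.mem_filter, mem_arcs] at ha
    refine T.x_ne h3.le h4 (by omega) fun s hs1 hs2 hs3 hs4 => ?_
    rcases lt_or_gt_of_ne hs3 with h | h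
    · exact h9 s h (by omega) hs4
    · have := h5.1.le_of_lt h hs4
      omega
  · intro a ha b hb _ hab
    simp only [shortAtStart, Finset.mem_filter] at ha hb
    exact arcs_snd_injOn a ha.1 b hb.1 (by exact_mod_cast hab)
  · intro a ha b hb hab hlt
    have hlt : a.2 < b.2 := by exact_mod_cast hlt
    obtain ⟨h1, h2, h3, h4⟩ := hp a ha
    obtain ⟨h5, h6, h7, h8, h9, h10, h11⟩ := hP _ h1
    simp only [shortAtStart, Finset.mem_filter, mem_arcs] at ha hb
    have hle := hb.1.1.le_of_lt' hlt (ha.1.1.eq.symm.trans hab)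
    refine T.x_eq hb.1.1.lt.le (by omega) fun s hs1 hs2 hs3 => ?_
    have := h5.1.le_of_lt (t := s) (by omega) hs3
    omega
  · intro a ha
    obtain ⟨h1, h2, h3, h4⟩ := hp a ha
    have h5 := hP.lt h1
    have h6 := hP _ h1
    simp only [shortAtStart, Finset.mem_filter, mem_arcs] at ha
    rw [show 2 ^ (k + 1) = 2 * 2 ^ k by ring]
    refine ⟨ha.1.1, ha.1.2, ?_, ?_⟩ <;> omega

/-- Time reversal of the previous bound; the key is therefore the negated left end. -/
lemma Expensive.card_shortAtEnd_le (hG : T.Expensive G) {P : Finset (ℕ × ℕ)}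
    (hP : T.IsBalancedCut P D k c) : G * (T.shortAtEnd P D k c).card ≤ 2 ^ (k + 3) := by
  classical
  refine le_trans ?_ (window_le (c := c) (k := k) (D := D))
  have hex : ∀ a : ℕ × ℕ, ∃ b, a ∈ T.shortAtEnd P D k c →
      b ∈ P ∧ T.adj (T.σ a.1) (T.σ b.1) ∧ a.1 < b.2 ∧ b.2 < a.2 := by
    intro a
    by_cases ha : a ∈ T.shortAtEnd P D k c
    · simp only [shortAtEnd, Finset.mem_filter] at ha
      obtain ⟨b, hb⟩ := ha.2.2.2
      exact ⟨b, fun _ => hb⟩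
    · exact ⟨0, fun h => absurd h ha⟩
  choose p hp using hex
  refine hG.le_of_window (piv := fun a => T.σ (p a).2) (key := fun a => -(a.1 : ℤ))
    ⟨?_, ?_, ?_, ?_⟩ ?_
  · intro a ha
    obtain ⟨h1, h2, -⟩ := hp a ha
    rwa [← (hP _ h1).1.1.eq]
  · intro a ha
    obtain ⟨h1, h2, h3, h4⟩ := hp a ha
    obtain ⟨h5, h6, h7, h8, h9, h10, h11⟩ := hP _ h1
    simp only [shortAtEnd, Finset.mem_filter, mem_arcs] at ha
    refine T.x_ne h3.le h4 (by omega) fun s hs1 hs2 hs3 hs4 => ?_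
    rcases lt_or_gt_of_ne hs3 with h | h
    · have := h5.1.le_of_lt' h (hs4.trans h5.1.eq.symm)
      omega
    · exact h10 s h (by omega) (by omega) hs4
  · intro a ha b hb _ hab
    simp only [shortAtEnd, Finset.mem_filter] at ha hb
    exact arcs_fst_injOn a ha.1 b hb.1 (by simpa using hab)
  · intro a ha b hb hab hlt
    have hlt : b.1 < a.1 := by simpa using hlt
    obtain ⟨h1, h2, h3, h4⟩ := hp a ha
    obtain ⟨h5, h6, h7, h8, h9, h10, h11⟩ := hP _ h1
    simp only [shortAtEnd, Finset.mem_filter, mem_arcs] at ha hb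
    have hle := hb.1.1.le_of_lt hlt hab
    refine T.x_eq hb.1.1.lt.le (by omega) fun s hs1 hs2 hs3 => ?_
    have := h5.1.le_of_lt' (t := s) (by omega) (hs3.trans h5.1.eq.symm)
    omega
  · intro a ha
    obtain ⟨h1, h2, h3, h4⟩ := hp a ha
    have h5 := hP.lt h1
    have h6 := hP _ h1
    simp only [shortAtEnd, Finset.mem_filter, mem_arcs] at ha
    rw [show 2 ^ (k + 1) = 2 * 2 ^ k by ring]
    refine ⟨ha.1.1, ha.1.2, ?_, ?_⟩ <;> omega

open Classical in
/-- The flips recorded in order to reconstruct the arcs in `P`. -/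
noncomputable def recordedTimes (T : FlipTrace n) (P : Finset (ℕ × ℕ)) (D k c : ℕ) : Finset ℕ :=
  (P.image Prod.fst ∪ P.image Prod.snd ∪ Finset.Ico (c - 2 ^ (k - D)) (c + 2 ^ (k - D)) ∪
    T.midEnds D k c ∪ (T.clusterEnds D k c).image Prod.snd ∪
    (T.clusterStarts D k c).image Prod.fst ∪ (T.shortAtStart P D k c).image Prod.snd ∪
    (T.shortAtEnd P D k c).image Prod.fst).filter (· < T.L)

/-- Classify the first flip `t` of a neighbour inside an arc of `P` by the gap before it. A short
gap gives an arc containing the start of the arc in `P`, unless `t` is close to the cut; a medium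
gap makes `t` an end of a mid arc. After a long gap the next flip cannot be far away, since `t` is
not isolated, so the arc starting at `t` is short (`clusterStarts`) or mid. Last flips are
symmetric. -/
lemma recorded_recordedTimes {P : Finset (ℕ × ℕ)} (hP : T.IsBalancedCut P D k c) :
    T.Recorded P (T.recordedTimes P D k c) := by
  have hk1 : 2 ^ (k + 1) = 2 * 2 ^ k := by ring
  constructor
  · intro t ht
    simp only [recordedTimes, Finset.mem_filter] at ht
    exact ht.2
  · exact fun a ha => (hP a ha).1.1
  · intro a ha
    have h := (hP a ha).1
    have := h.1.lt
    simp only [recordedTimes, Finset.mem_filter, Finset.mem_union]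
    have : a.1 ∈ P.image Prod.fst := Finset.mem_image_of_mem _ ha
    exact ⟨.inl <| .inl <| .inl <| .inl <| .inl <| .inl <| .inl this, by omega⟩
  · intro a ha
    have h := (hP a ha).1
    simp only [recordedTimes, Finset.mem_filter, Finset.mem_union]
    have : a.2 ∈ P.image Prod.snd := Finset.mem_image_of_mem _ ha
    exact ⟨.inl <| .inl <| .inl <| .inl <| .inl <| .inl <| .inr this, h.2⟩
  · intro a ha t hat hta hadj hfirst
    obtain ⟨h5, h6, h7, h8, h9, h10, h11⟩ := hP _ ha
    have hlen := hP.lt ha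
    simp only [recordedTimes, Finset.mem_filter, Finset.mem_union]
    refine ⟨?_, by omega⟩
    have hw : c ≤ t + 2 ^ (k + 1) ∧ t < c + 2 ^ (k + 1) := by rw [hk1]; omega
    have hends : ∀ b ∈ T.midArcs D k, b.1 = t ∨ b.2 = t → t ∈ T.midEnds D k c := by
      intro b hb hbt
      simp only [midEnds, Finset.mem_filter, Finset.mem_union, Finset.mem_image]
      exact ⟨hbt.imp (fun h => ⟨b, hb, h⟩) fun h => ⟨b, hb, h⟩, hw⟩
    by_cases hL : T.QuietLeft t (2 ^ (k - D))
    · have hniso : ¬ (T.QuietLeft t (2 ^ (k + D)) ∧ T.QuietRight t (2 ^ (k + D))) := by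
        intro hc
        exact h11 ⟨t, hat, hta, hadj, by rw [h6]; exact hc.1, by rw [h6]; exact hc.2⟩
      by_cases hLH : T.QuietLeft t (2 ^ (k + D))
      -- The degenerate pair `(t, t)` serves only to supply the time `t`.
      · obtain ⟨s, hs1, hs2, hs3⟩ := exists_after (a := (t, t)) fun h => hniso ⟨hLH, h⟩
        dsimp only at hs1 hs2 hs3
        have := hs1.lt
        by_cases hs : s - t < 2 ^ (k - D)
        · have : t ∈ (T.clusterStarts D k c).image Prod.fst := by
            rw [Finset.mem_image]
            refine ⟨(t, s), ?_, rfl⟩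
            simp only [clusterStarts, Finset.mem_filter, mem_arcs]
            exact ⟨⟨hs1, hs3⟩, hs, hLH, hw⟩
          exact .inl <| .inl <| .inr this
        · have := hends (t, s) (by
            simp only [midArcs, Finset.mem_filter, mem_arcs]
            exact ⟨⟨hs1, hs3⟩, by omega, by omega⟩) (Or.inl rfl)
          exact .inl <| .inl <| .inl <| .inl <| .inr this
      · obtain ⟨s, hs1, hs2⟩ := exists_before (a := (t, t)) hLH
        dsimp only at hs1 hs2
        have := hs1.lt
        have := hends (s, t) (by
          simp only [midArcs, Finset.mem_filter, mem_arcs]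
          refine ⟨⟨hs1, by omega⟩, ?_, by omega⟩
          by_contra hc
          exact hL s hs1.lt (by omega) hs1.eq) (Or.inr rfl)
        exact .inl <| .inl <| .inl <| .inl <| .inr this
    · obtain ⟨s, hs1, hs2⟩ := exists_before (a := (t, t)) hL
      dsimp only at hs1 hs2
      have hst := hs1.lt
      -- As `t` is the first flip of this neighbour inside `a`, its previous flip precedes `a`, and
      -- the arc from `s` to `t` contains the start of `a`.
      have hsa : s < a.1 := by
        rcases lt_trichotomy s a.1 with h | h | h
        · exact h
        · have h12 := T.adj_ne hadj
          rw [← h, hs1.eq] at h12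
          exact absurd rfl h12
        · exact absurd hs1.eq (hfirst s h hst)
      by_cases htc : t < c
      · have : t ∈ (T.shortAtStart P D k c).image Prod.snd := by
          rw [Finset.mem_image]
          refine ⟨(s, t), ?_, rfl⟩
          simp only [shortAtStart, Finset.mem_filter, mem_arcs]
          refine ⟨⟨hs1, by omega⟩, by omega, htc, a, ha, ?_, hsa, hat⟩
          rw [hs1.eq]
          exact T.adj_symm hadj
        exact .inl <| .inr this
      · have : t ∈ Finset.Ico (c - 2 ^ (k - D)) (c + 2 ^ (k - D)) := by
          rw [Finset.mem_Ico]
          generalize 2 ^ (k - D) = h at *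
          omega
        exact .inl <| .inl <| .inl <| .inl <| .inl <| .inr this
  · intro a ha t hat hta hadj hlast
    obtain ⟨h5, h6, h7, h8, h9, h10, h11⟩ := hP _ ha
    have hlen := hP.lt ha
    simp only [recordedTimes, Finset.mem_filter, Finset.mem_union]
    refine ⟨?_, by omega⟩
    have hw : c ≤ t + 2 ^ (k + 1) ∧ t < c + 2 ^ (k + 1) := by rw [hk1]; omega
    have hends : ∀ b ∈ T.midArcs D k, b.1 = t ∨ b.2 = t → t ∈ T.midEnds D k c := by
      intro b hb hbt
      simp only [midEnds, Finset.mem_filter, Finset.mem_union, Finset.mem_image]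
      exact ⟨hbt.imp (fun h => ⟨b, hb, h⟩) fun h => ⟨b, hb, h⟩, hw⟩
    by_cases hR : T.QuietRight t (2 ^ (k - D))
    · have hniso : ¬ (T.QuietLeft t (2 ^ (k + D)) ∧ T.QuietRight t (2 ^ (k + D))) := by
        intro hc
        exact h11 ⟨t, hat, hta, hadj, by rw [h6]; exact hc.1, by rw [h6]; exact hc.2⟩
      by_cases hRH : T.QuietRight t (2 ^ (k + D))
      · obtain ⟨s, hs1, hs2⟩ := exists_before (a := (t, t)) fun h => hniso ⟨h, hRH⟩
        dsimp only at hs1 hs2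
        have := hs1.lt
        by_cases hs : t - s < 2 ^ (k - D)
        · have : t ∈ (T.clusterEnds D k c).image Prod.snd := by
            rw [Finset.mem_image]
            refine ⟨(s, t), ?_, rfl⟩
            simp only [clusterEnds, Finset.mem_filter, mem_arcs]
            exact ⟨⟨hs1, by omega⟩, hs, hRH, hw⟩
          exact .inl <| .inl <| .inl <| .inr this
        · have := hends (s, t) (by
            simp only [midArcs, Finset.mem_filter, mem_arcs]
            exact ⟨⟨hs1, by omega⟩, by omega, by omega⟩) (Or.inr rfl)
          exact .inl <| .inl <| .inl <| .inl <| .inr this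
      · obtain ⟨s, hs1, hs2, hs3⟩ := exists_after (a := (t, t)) hRH
        dsimp only at hs1 hs2 hs3
        have := hs1.lt
        have := hends (t, s) (by
          simp only [midArcs, Finset.mem_filter, mem_arcs]
          refine ⟨⟨hs1, by omega⟩, ?_, by omega⟩
          by_contra hc
          exact hR s hs1.lt (by omega) hs3 hs1.eq.symm) (Or.inl rfl)
        exact .inl <| .inl <| .inl <| .inl <| .inr this
    · obtain ⟨s, hs1, hs2, hs3⟩ := exists_after (a := (t, t)) hR
      dsimp only at hs1 hs2 hs3
      have hst := hs1.lt
      have hsa : a.2 < s := by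
        rcases lt_trichotomy s a.2 with h | h | h
        · exact absurd hs1.eq.symm (hlast s hst h)
        · have h12 := T.adj_ne hadj
          rw [hs1.eq, h, h5.1.eq] at h12
          exact absurd rfl h12
        · exact h
      by_cases htc : c ≤ t
      · have : t ∈ (T.shortAtEnd P D k c).image Prod.fst := by
          rw [Finset.mem_image]
          refine ⟨(t, s), ?_, rfl⟩
          simp only [shortAtEnd, Finset.mem_filter, mem_arcs]
          exact ⟨⟨hs1, hs3⟩, by omega, htc, a, ha, T.adj_symm hadj, hta, hsa⟩
        exact .inr this
      · have : t ∈ Finset.Ico (c - 2 ^ (k - D)) (c + 2 ^ (k - D)) := by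
          rw [Finset.mem_Ico]
          generalize 2 ^ (k - D) = h at *
          omega
        exact .inl <| .inl <| .inl <| .inl <| .inl <| .inr this

/-- In units of `D * P.card`, the recorded flips cost at most `1` for the ends of the arcs, `32` for
the central interval, `256` for `midEnds`, and `1/4` for each of the other four families: less than
`512`. -/
lemma Expensive.false_of_balancedCut (hD : 2 ≤ D) (hG : T.Expensive (512 * D))
    {P : Finset (ℕ × ℕ)} (hP : T.IsBalancedCut P D k c) (hk : 2 ^ k ≤ 16 * D ^ 2 * P.card)
    (hmid : (T.midEnds D k c).card ≤ 256 * D * P.card) : False := by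
  classical
  have hpos : 0 < P.card := by
    by_contra hc
    have : P.card = 0 := by omega
    rw [this] at hk
    have := Nat.pow_pos (n := k) (show 0 < 2 by norm_num)
    omega
  obtain ⟨piv, hord⟩ := ordered_of_injOn (T := T) (S := P) (fun a ha => (hP a ha).1)
    fun a ha b hb hab => eq_of_crossing (hP a ha).1.1 (hP b hb).1.1 (hP a ha).2.2.1
      (hP a ha).2.2.2.1 (hP b hb).2.2.1 (hP b hb).2.2.2.1 hab
  have hlt := hG P _ piv _ (Finset.card_pos.mp hpos) hord (recorded_recordedTimes hP)
  have hcard : (T.recordedTimes P D k c).card ≤ P.card + P.card + 2 * 2 ^ (k - D) +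
      (T.midEnds D k c).card + (T.clusterEnds D k c).card + (T.clusterStarts D k c).card +
      (T.shortAtStart P D k c).card + (T.shortAtEnd P D k c).card := by
    refine (Finset.card_filter_le _ _).trans ?_
    refine (Finset.card_union_le _ _).trans (add_le_add ?_ Finset.card_image_le)
    refine (Finset.card_union_le _ _).trans (add_le_add ?_ Finset.card_image_le)
    refine (Finset.card_union_le _ _).trans (add_le_add ?_ Finset.card_image_le)
    refine (Finset.card_union_le _ _).trans (add_le_add ?_ Finset.card_image_le)
    refine (Finset.card_union_le _ _).trans (add_le_add ?_ le_rfl)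
    refine (Finset.card_union_le _ _).trans (add_le_add ?_ ?_)
    · exact (Finset.card_union_le _ _).trans (add_le_add Finset.card_image_le Finset.card_image_le)
    · rw [Nat.card_Ico]
      generalize 2 ^ (k - D) = h at *
      omega
  have hsmall : ∀ y, 512 * D * y ≤ 2 ^ (k + 3) → 4 * y ≤ D * P.card := by
    intro y hy
    have h1 : 512 * D * y ≤ 8 * (16 * D ^ 2 * P.card) := by
      rw [show 2 ^ (k + 3) = 8 * 2 ^ k by ring] at hy
      omega
    refine Nat.le_of_mul_le_mul_left (show 128 * D * (4 * y) ≤ 128 * D * (D * P.card) from ?_)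
      (by omega)
    linarith
  have h1 := hsmall _ (hG.card_clusterEnds_le (k := k) (c := c) hD)
  have h2 := hsmall _ (hG.card_clusterStarts_le (k := k) (c := c) hD)
  have h3 := hsmall _ (hG.card_shortAtStart_le hP)
  have h4 := hsmall _ (hG.card_shortAtEnd_le hP)
  have h5 : 2 ^ (k - D) ≤ 16 * (D * P.card) := by
    -- The factor `D ≤ 2 ^ D` saved by the narrow central interval turns `D ^ 2` into `D`; for `k ≤
    -- D` the exponent truncates to `0`.
    rcases le_total D k with hDk | hDk
    · refine Nat.le_of_mul_le_mul_left (show 2 ^ D * 2 ^ (k - D) ≤ 2 ^ D * (16 * (D * P.card)) from ?_)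
        (by positivity)
      have hDD : D ≤ 2 ^ D := Nat.lt_two_pow_self.le
      calc 2 ^ D * 2 ^ (k - D) = 2 ^ k := by rw [← pow_add]; congr 1; omega
        _ ≤ 16 * D ^ 2 * P.card := hk
        _ = D * (16 * (D * P.card)) := by ring
        _ ≤ _ := Nat.mul_le_mul_right _ hDD
    · rw [show k - D = 0 by omega]
      have : 0 < D * P.card := by positivity
      omega
  have h6 : P.card + P.card ≤ D * P.card := by nlinarith
  have h7 : 512 * D * P.card = 512 * (D * P.card) := by ring
  have h8 : 256 * D * P.card = 256 * (D * P.card) := by ring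
  rw [h7] at hlt
  rw [h8] at hmid
  omega

end FlipTrace

/-! ### Choosing the scale and the cut by averaging -/

namespace FlipTrace

variable {n : ℕ} (T : FlipTrace n) {R D G k c : ℕ}

open Classical in
/-- The arcs of length less than `2 ^ R` that have no much shorter neighbouring arcs and contain no
isolated flip of a neighbour. -/
noncomputable def balanced (R D : ℕ) : Finset (ℕ × ℕ) :=
  (T.arcs.filter fun a => a.2 - a.1 < 2 ^ R) \
    (T.shortBefore R D ∪ T.shortAfter R D ∪ T.withIsolated R D)

variable {T}

lemma mem_balanced {a : ℕ × ℕ} : a ∈ T.balanced R D ↔ a ∈ T.arcs ∧ a.2 - a.1 < 2 ^ R ∧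
    T.QuietLeft a.1 (2 ^ (scale a - D)) ∧ T.QuietRight a.2 (2 ^ (scale a - D)) ∧
    ¬ T.HasIsolated D a := by
  simp only [balanced, shortBefore, shortAfter, withIsolated, Finset.mem_sdiff, Finset.mem_union,
    Finset.mem_filter]
  tauto

lemma card_arcs_le : T.arcs.card ≤ T.L := by
  have := Finset.card_le_card_of_injOn (s := T.arcs) (t := Finset.range T.L) Prod.snd
    (fun a ha => by simpa using (mem_arcs.mp ha).2)
    (fun a ha b hb hab => arcs_snd_injOn a ha b hb hab)
  simpa using this

/-- With `D ^ 2` scales and price `512 * D`, the three atypical families have at most `1/128`,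
`1/128` and `3/128` of `T.L` members, out of at least `T.L / 2` short arcs. -/
lemma Expensive.le_card_balanced (hD : 2 ≤ D) (hG : T.Expensive (512 * D))
    (hn : 4 * n ≤ 2 ^ (D ^ 2)) (hL : 2 ^ (D ^ 2 + D) ≤ T.L) :
    T.L ≤ 4 * (T.balanced (D ^ 2) D).card := by
  classical
  have hL' : 2 ^ (D ^ 2) ≤ T.L := (Nat.pow_le_pow_right (by norm_num) (by omega)).trans hL
  have h1 := hG.card_shortBefore_le (D := D) hL'
  have h2 := hG.card_shortAfter_le (D := D) hL'
  have h3 := hG.card_withIsolated_le (D := D) (by omega) hL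
  have h4 := half_le_card_short (T := T) hn (hn.trans hL')
  have h5 := Finset.card_le_card_sdiff_add_card
    (t := T.shortBefore (D ^ 2) D ∪ T.shortAfter (D ^ 2) D ∪ T.withIsolated (D ^ 2) D)
    (s := T.arcs.filter fun a => a.2 - a.1 < 2 ^ (D ^ 2))
  have h6 := Finset.card_union_le (T.shortBefore (D ^ 2) D ∪ T.shortAfter (D ^ 2) D)
    (T.withIsolated (D ^ 2) D)
  have h7 := Finset.card_union_le (T.shortBefore (D ^ 2) D) (T.shortAfter (D ^ 2) D)
  change _ ≤ (T.balanced (D ^ 2) D).card + _ at h5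
  generalize (T.shortBefore (D ^ 2) D).card = b₁ at *
  generalize (T.shortAfter (D ^ 2) D).card = b₂ at *
  generalize (T.withIsolated (D ^ 2) D).card = b₃ at *
  have e1 : 128 * b₁ ≤ T.L :=
    Nat.le_of_mul_le_mul_left (show 4 * D ^ 2 * (128 * b₁) ≤ 4 * D ^ 2 * T.L by linarith)
      (by positivity)
  have e2 : 128 * b₂ ≤ T.L :=
    Nat.le_of_mul_le_mul_left (show 4 * D ^ 2 * (128 * b₂) ≤ 4 * D ^ 2 * T.L by linarith)
      (by positivity)
  have e3 : 128 * b₃ ≤ 3 * T.L := by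
    obtain ⟨d, rfl⟩ : ∃ d, D = d + 2 := ⟨D - 2, by omega⟩
    rw [show d + 2 - 1 = d + 1 by omega] at h3
    refine Nat.le_of_mul_le_mul_left (show 4 * (d + 2) * (d + 1) * (128 * b₃) ≤
      4 * (d + 2) * (d + 1) * (3 * T.L) from ?_) (by positivity)
    calc 4 * (d + 2) * (d + 1) * (128 * b₃) = (d + 1) * (512 * (d + 2) * b₃) := by ring
      _ ≤ 4 * T.L * ((d + 2) ^ 2 + (d + 2)) := h3
      _ = 4 * (d + 2) * (d + 3) * T.L := by ring
      _ ≤ 4 * (d + 2) * (3 * (d + 1)) * T.L := by gcongr; omega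
      _ = _ := by ring
  omega

/-- An arc is counted only for the at most `2 * D` values of `k` near its own scale. -/
lemma sum_card_midArcs_le (R D : ℕ) :
    ∑ k ∈ Finset.range R, (T.midArcs D k).card ≤ 2 * D * T.L := by
  have hdc := Finset.sum_card_bipartiteAbove_eq_sum_card_bipartiteBelow
      (s := Finset.range R) (t := T.arcs)
      fun k a => 2 ^ (k - D) ≤ a.2 - a.1 ∧ a.2 - a.1 < 2 ^ (k + D)
  simp only [Finset.bipartiteAbove, Finset.bipartiteBelow] at hdc
  simp only [midArcs]
  rw [hdc]
  refine (Finset.sum_le_card_nsmul _ _ (2 * D) fun a ha => ?_).trans ?_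
  · have : (Finset.range R).filter (fun k => 2 ^ (k - D) ≤ a.2 - a.1 ∧ a.2 - a.1 < 2 ^ (k + D)) ⊆
        Finset.Ico (scale a + 1 - D) (scale a + D + 1) := by
      intro k hk
      simp only [Finset.mem_filter, Finset.mem_Ico] at hk ⊢
      have h1 : k - D ≤ scale a := Nat.le_log_of_pow_le (by norm_num) hk.2.1
      have h2 : scale a < k + D := scale_lt (mem_arcs.mp ha).1.lt hk.2.2
      omega
    refine (Finset.card_le_card this).trans ?_
    rw [Nat.card_Ico]
    omega
  · rw [smul_eq_mul, mul_comm]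
    exact Nat.mul_le_mul_left _ card_arcs_le

lemma sum_card_midEnds_le (D k : ℕ) :
    ∑ c ∈ Finset.range T.L, (T.midEnds D k c).card ≤ 8 * 2 ^ k * (T.midArcs D k).card := by
  classical
  set B := (T.midArcs D k).image Prod.fst ∪ (T.midArcs D k).image Prod.snd with hB
  have hdc := Finset.sum_card_bipartiteAbove_eq_sum_card_bipartiteBelow
      (s := Finset.range T.L) (t := B) fun c t => c ≤ t + 2 ^ (k + 1) ∧ t < c + 2 ^ (k + 1)
  simp only [Finset.bipartiteAbove, Finset.bipartiteBelow] at hdc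
  simp only [midEnds]
  rw [← hB, hdc]
  have hBc : B.card ≤ 2 * (T.midArcs D k).card := by
    refine (Finset.card_union_le _ _).trans ?_
    have h1 : ((T.midArcs D k).image Prod.fst).card ≤ _ := Finset.card_image_le
    have h2 : ((T.midArcs D k).image Prod.snd).card ≤ _ := Finset.card_image_le
    omega
  refine (Finset.sum_le_card_nsmul _ _ (4 * 2 ^ k) fun t ht => ?_).trans ?_
  · have : (Finset.range T.L).filter (fun c => c ≤ t + 2 ^ (k + 1) ∧ t < c + 2 ^ (k + 1)) ⊆
        Finset.Ico (t + 1 - 2 ^ (k + 1)) (t + 2 ^ (k + 1) + 1) := by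
      intro c hc
      simp only [Finset.mem_filter, Finset.mem_Ico] at hc ⊢
      generalize 2 ^ (k + 1) = m at *
      omega
    refine (Finset.card_le_card this).trans ?_
    rw [Nat.card_Ico, show 4 * 2 ^ k = 2 * 2 ^ (k + 1) by ring]
    generalize 2 ^ (k + 1) = m at *
    omega
  · rw [smul_eq_mul]
    nlinarith [Nat.pow_pos (n := k) (show 0 < 2 by norm_num)]

/-- Summed over the `D ^ 2` scales, the left sides give at most `4 * D ^ 2 * T.L`, the right sides
at least `8 * D ^ 2 * T.L`. -/
lemma exists_scale (hD : 2 ≤ D) (hLpos : 0 < T.L) (hN : T.L ≤ 4 * (T.balanced (D ^ 2) D).card) :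
    ∃ k, 2 * T.L + D * (T.midArcs D k).card ≤
      32 * D ^ 2 * ((T.balanced (D ^ 2) D).filter fun a => scale a = k).card := by
  by_contra! hc
  have h1 := Finset.sum_le_sum fun k (_ : k ∈ Finset.range (D ^ 2)) => (hc k).le
  simp only [Finset.sum_add_distrib, ← Finset.mul_sum, Finset.sum_const, Finset.card_range,
    smul_eq_mul] at h1
  rw [← Finset.card_eq_sum_card_fiberwise] at h1
  · have h2 := T.sum_card_midArcs_le (D ^ 2) D
    have h3 : 32 * D ^ 2 * (T.balanced (D ^ 2) D).card ≤ 4 * D ^ 2 * T.L := by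
      calc _ ≤ _ := h1
        _ ≤ 2 * (D ^ 2 * T.L) + D * (2 * D * T.L) := by gcongr
        _ = _ := by ring
    have h4 : 8 * (T.balanced (D ^ 2) D).card ≤ T.L :=
      Nat.le_of_mul_le_mul_left (show 4 * D ^ 2 * (8 * (T.balanced (D ^ 2) D).card) ≤
        4 * D ^ 2 * T.L by linarith) (by positivity)
    omega
  · intro a ha
    obtain ⟨h2, h3, -⟩ := mem_balanced.mp ha
    simpa using scale_lt (mem_arcs.mp h2).1.lt h3

/-- Average over cuts: an arc of scale `k` crosses at least `2 ^ k` cuts, while an end of a mid arc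
is near at most `4 * 2 ^ k` of them. -/
lemma exists_cut (hLpos : 0 < T.L) {B : Finset (ℕ × ℕ)} (hB : B ⊆ T.arcs)
    (hk : ∀ a ∈ B, scale a = k)
    (h : 2 * T.L + D * (T.midArcs D k).card ≤ 32 * D ^ 2 * B.card) :
    ∃ c, 16 * 2 ^ k + D * (T.midEnds D k c).card ≤
      256 * D ^ 2 * (B.filter fun a => a.1 < c ∧ c ≤ a.2).card := by
  by_contra! hc
  have h1 := Finset.sum_lt_sum_of_nonempty (s := Finset.range T.L)
    (Finset.nonempty_range_iff.mpr hLpos.ne') fun c _ => hc c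
  simp only [Finset.sum_add_distrib, ← Finset.mul_sum, Finset.sum_const, Finset.card_range,
    smul_eq_mul] at h1
  rw [sum_crossing hB] at h1
  have h2 := T.sum_card_midEnds_le D k
  have h3 : 2 ^ k * B.card ≤ ∑ a ∈ B, (a.2 - a.1) := by
    rw [mul_comm, ← smul_eq_mul]
    refine Finset.card_nsmul_le_sum _ _ _ fun a ha => ?_
    rw [← hk a ha]
    exact pow_scale_le (mem_arcs.mp (hB ha)).1.lt
  have h4 : 256 * D ^ 2 * (2 ^ k * B.card) < 8 * 2 ^ k * (2 * T.L + D * (T.midArcs D k).card) := by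
    calc _ ≤ 256 * D ^ 2 * ∑ a ∈ B, (a.2 - a.1) := by gcongr
      _ < _ := h1
      _ ≤ 16 * (T.L * 2 ^ k) + D * (8 * 2 ^ k * (T.midArcs D k).card) := by gcongr
      _ = _ := by ring
  have h5 : 8 * 2 ^ k * (2 * T.L + D * (T.midArcs D k).card) ≤
      8 * 2 ^ k * (32 * D ^ 2 * B.card) := by gcongr
  linarith

lemma not_expensive (hD : 2 ≤ D) (hn : 4 * n ≤ 2 ^ (D ^ 2)) (hL : 2 ^ (D ^ 2 + D) ≤ T.L) :
    ¬ T.Expensive (512 * D) := by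
  intro hG
  have hLpos : 0 < T.L := lt_of_lt_of_le (by positivity) hL
  obtain ⟨k, hk⟩ := exists_scale hD hLpos (hG.le_card_balanced hD hn hL)
  obtain ⟨c, hc⟩ := exists_cut hLpos (fun a ha =>
    (mem_balanced.mp (Finset.mem_filter.mp ha).1).1) (fun a ha => (Finset.mem_filter.mp ha).2) hk
  set P := ((T.balanced (D ^ 2) D).filter fun a => scale a = k).filter
    fun a => a.1 < c ∧ c ≤ a.2 with hP
  refine hG.false_of_balancedCut (k := k) (c := c) (P := P) hD ?_ ?_ ?_
  · intro a ha
    simp only [hP, Finset.mem_filter, mem_balanced, mem_arcs] at ha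
    obtain ⟨⟨⟨h1, h2, h3, h4, h5⟩, rfl⟩, h6, h7⟩ := ha
    exact ⟨h1, rfl, h6, h7, h3, h4, h5⟩
  · have : 16 * 2 ^ k ≤ 256 * D ^ 2 * P.card := le_trans (Nat.le_add_right _ _) hc
    linarith
  · refine Nat.le_of_mul_le_mul_left (show D * (T.midEnds D k c).card ≤
      D * (256 * D * P.card) from ?_) (by omega)
    calc _ ≤ _ := le_trans (Nat.le_add_left _ _) hc
      _ = _ := by ring

/-- In every long enough sequence of flips there is a nonempty triangular set of rows that can be
reconstructed from a small number of recorded flips per row. -/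
theorem exists_triangular_recorded (T : FlipTrace n) (hD : 2 ≤ D) (hn : 4 * n ≤ 2 ^ (D ^ 2))
    (hL : 2 ^ (D ^ 2 + D) ≤ T.L) :
    ∃ S E piv, S.Nonempty ∧ T.Triangular S piv ∧ T.Recorded S E ∧ E.card ≤ 1024 * D * S.card := by
  have h := not_expensive (T := T) hD hn hL
  simp only [Expensive] at h
  push Not at h
  obtain ⟨S, E, piv, key, hne, hord, hrec, hcard⟩ := h
  obtain ⟨S₁, hS₁, hle, htri⟩ := hord.exists_triangular
  refine ⟨S₁, E, piv, ?_, htri, hrec.mono hS₁, ?_⟩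
  · rw [← Finset.card_pos] at hne ⊢
    omega
  · calc E.card ≤ 512 * D * S.card := hcard
      _ ≤ 512 * D * (2 * S₁.card) := by gcongr
      _ = _ := by ring

end FlipTrace

/-! ### Anticoncentration of triangular linear forms -/

lemma IsSmoothWeightLaw.measure_Icc_le {φ : ℝ} {μ : Measure ℝ} (h : IsSmoothWeightLaw φ μ)
    (a b : ℝ) : μ (Set.Icc a b) ≤ ENNReal.ofReal φ * ENNReal.ofReal (b - a) := by
  obtain ⟨f, -, hμ, hf⟩ := h.density
  rw [hμ, withDensity_apply _ measurableSet_Icc]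
  calc ∫⁻ x in Set.Icc a b, f x ≤ ∫⁻ _ in Set.Icc a b, ENNReal.ofReal φ := lintegral_mono hf
    _ = _ := by rw [setLIntegral_const, Real.volume_Icc]

/-- Unit mass lies on an interval of length `2`. This later absorbs additive constants into `φ * m`.
-/
lemma IsSmoothWeightLaw.half_le {φ : ℝ} {μ : Measure ℝ} (h : IsSmoothWeightLaw φ μ) :
    1 ≤ 2 * φ := by
  have := h.isProbabilityMeasure
  have h1 : μ (Set.Icc (-1) 1) = 1 := by
    rw [prob_compl_eq_zero_iff measurableSet_Icc |>.mp h.supported]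
  have h2 := h.measure_Icc_le (-1) 1
  rw [h1, mul_comm, ← ENNReal.ofReal_mul (by norm_num)] at h2
  rw [← ENNReal.ofReal_one] at h2
  by_contra hc
  have := (ENNReal.ofReal_lt_ofReal_iff (p := (1 - -1) * φ) (q := 1) one_pos).mpr (by linarith)
  exact absurd h2 (not_le.mpr this)

/-- Integrating out one coordinate first. -/
lemma lintegral_pi_eq_lintegral_update {m : ℕ} (μ : Fin m → Measure ℝ)
    [∀ i, IsProbabilityMeasure (μ i)] (i : Fin m) {f : (Fin m → ℝ) → ℝ≥0∞} (hf : Measurable f) :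
    ∫⁻ w, f w ∂Measure.pi μ = ∫⁻ w, ∫⁻ y, f (Function.update w i y) ∂μ i ∂Measure.pi μ := by
  classical
  have hg : (fun w => ∫⁻ y, f (Function.update w i y) ∂μ i) = ∫⋯∫⁻_{i}, f ∂μ :=
    (lmarginal_singleton f i).symm
  rw [hg]
  have hgm : Measurable (∫⋯∫⁻_{i}, f ∂μ) := hf.lmarginal μ
  rw [lintegral_eq_lmarginal_univ (f := f) 0, lintegral_eq_lmarginal_univ (f := ∫⋯∫⁻_{i}, f ∂μ) 0,
    lmarginal_erase' (f := f) hf (Finset.mem_univ i),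
    lmarginal_erase' (f := ∫⋯∫⁻_{i}, f ∂μ) hgm (Finset.mem_univ i), ← hg]
  simp

/-- Linear forms in triangular form are unlikely to be small simultaneously. -/
lemma pi_measure_forms_le {m : ℕ} {φ κ δ : ℝ} {μ : Fin m → Measure ℝ}
    (hμ : ∀ i, IsSmoothWeightLaw φ (μ i)) (hκ : 0 < κ)
    {α : Type*} [DecidableEq α] (cf : α → Fin m → ℝ) (col : α → Fin m) (S : Finset α)
    (hpiv : ∀ a ∈ S, κ ≤ |cf a (col a)|)
    (htri : ∀ S' ⊆ S, S'.Nonempty → ∃ a ∈ S', ∀ b ∈ S', b ≠ a → cf b (col a) = 0) :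
    Measure.pi μ {w | ∀ a ∈ S, |∑ i, w i * cf a i| ≤ δ} ≤
      (ENNReal.ofReal φ * ENNReal.ofReal (2 * δ / κ)) ^ S.card := by
  have hprob : ∀ i, IsProbabilityMeasure (μ i) := fun i => (hμ i).isProbabilityMeasure
  have hmeas : ∀ S : Finset α, MeasurableSet {w : Fin m → ℝ | ∀ a ∈ S, |∑ i, w i * cf a i| ≤ δ} := by
    intro S
    simp only [Set.ofPred_forall]
    refine Finset.measurableSet_biInter S fun a _ => ?_
    exact measurableSet_le (by fun_prop) (by fun_prop)
  induction hc : S.card generalizing S with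
  | zero =>
    rw [pow_zero]
    exact prob_le_one
  | succ r ih =>
    -- The weight at `col a` occurs in no other form, so integrating it out first affects only the
    -- row `a`.
    obtain ⟨a, ha, hb⟩ := htri S (Finset.Subset.refl _) (Finset.card_pos.mp (by omega))
    have ih' := ih (S.erase a) (fun b hb => hpiv b (Finset.mem_of_mem_erase hb))
      (fun S' hS' => htri S' (hS'.trans (Finset.erase_subset _ _)))
      (by rw [Finset.card_erase_of_mem ha]; omega)
    set A := {w : Fin m → ℝ | ∀ b ∈ S.erase a, |∑ i, w i * cf b i| ≤ δ} with hA
    set B := {w : Fin m → ℝ | ∀ b ∈ S, |∑ i, w i * cf b i| ≤ δ} with hB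
    have hsum : ∀ (w : Fin m → ℝ) (y : ℝ) (b : α),
        ∑ i, Function.update w (col a) y i * cf b i =
          y * cf b (col a) + ∑ i ∈ Finset.univ.erase (col a), w i * cf b i := by
      intro w y b
      rw [← Finset.add_sum_erase _ _ (Finset.mem_univ (col a)), Function.update_self]
      congr 1
      exact Finset.sum_congr rfl fun i hi => by
        rw [Function.update_of_ne (Finset.ne_of_mem_erase hi)]
    have hAup : ∀ w y, Function.update w (col a) y ∈ A ↔ w ∈ A := by
      intro w y
      simp only [hA, Set.mem_ofPred_eq]
      refine forall₂_congr fun b hbS => ?_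
      rw [hsum, ← Finset.add_sum_erase _ (fun i => w i * cf b i) (Finset.mem_univ (col a)),
        hb b (Finset.mem_of_mem_erase hbS) (Finset.ne_of_mem_erase hbS)]
      simp
    -- With the other weights fixed, the form `a` is small only if its pivot weight lies in an
    -- interval of length `2 * δ / κ`.
    have hslice : ∀ w, ∫⁻ y, B.indicator 1 (Function.update w (col a) y) ∂μ (col a) ≤
        A.indicator (fun _ => ENNReal.ofReal φ * ENNReal.ofReal (2 * δ / κ)) w := by
      intro w
      set R := ∑ i ∈ Finset.univ.erase (col a), w i * cf a i with hR
      have hκa := hpiv a ha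
      set q := cf a (col a) with hq
      have hle : ∀ y, B.indicator (1 : (Fin m → ℝ) → ℝ≥0∞) (Function.update w (col a) y) ≤
          A.indicator (fun _ => (Set.Icc (-R / q - δ / κ) (-R / q + δ / κ)).indicator
            (1 : ℝ → ℝ≥0∞) y) w := by
        intro y
        by_cases hy : Function.update w (col a) y ∈ B
        · have hyA : Function.update w (col a) y ∈ A := fun b hb => hy b (Finset.mem_of_mem_erase hb)
          rw [Set.indicator_of_mem hy, Set.indicator_of_mem ((hAup w y).mp hyA)]
          have h1 := hy a ha
          rw [hsum] at h1
          have hq0 : q ≠ 0 := by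
            intro h0; rw [h0, abs_zero] at hκa; linarith
          have h2 : |y + R / q| ≤ δ / κ := by
            have : y * q + R = (y + R / q) * q := by field_simp
            rw [this, abs_mul] at h1
            rw [le_div_iff₀ hκ]
            exact (mul_le_mul_of_nonneg_left hκa (abs_nonneg _)).trans h1
          rw [abs_le] at h2
          have : y ∈ Set.Icc (-R / q - δ / κ) (-R / q + δ / κ) := by
            rw [neg_div]
            constructor <;> linarith
          rw [Set.indicator_of_mem this]
          simp
        · rw [Set.indicator_of_notMem hy]; exact zero_le
      refine (lintegral_mono hle).trans ?_
      by_cases hw : w ∈ A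
      · simp only [Set.indicator_of_mem hw]
        rw [lintegral_indicator_one measurableSet_Icc]
        refine ((hμ (col a)).measure_Icc_le _ _).trans ?_
        rw [show -R / q + δ / κ - (-R / q - δ / κ) = 2 * δ / κ by ring]
      · simp only [Set.indicator_of_notMem hw]
        simp
    calc Measure.pi μ B = ∫⁻ w, B.indicator 1 w ∂Measure.pi μ :=
          (lintegral_indicator_one (hmeas S)).symm
      _ = ∫⁻ w, ∫⁻ y, B.indicator 1 (Function.update w (col a) y) ∂μ (col a) ∂Measure.pi μ :=
          lintegral_pi_eq_lintegral_update μ (col a) (measurable_one.indicator (hmeas S))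
      _ ≤ ∫⁻ w, A.indicator (fun _ => ENNReal.ofReal φ * ENNReal.ofReal (2 * δ / κ)) w
            ∂Measure.pi μ := lintegral_mono hslice
      _ = ENNReal.ofReal φ * ENNReal.ofReal (2 * δ / κ) * Measure.pi μ A := by
          rw [lintegral_indicator_const (hmeas _)]
      _ ≤ ENNReal.ofReal φ * ENNReal.ofReal (2 * δ / κ) *
            (ENNReal.ofReal φ * ENNReal.ofReal (2 * δ / κ)) ^ r := by gcongr
      _ = _ := by rw [pow_succ']

/-! ### Slopes of the objective and the trace of a FLIP run -/

/-- The real number `0` or `1` given by a Boolean value. -/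
def boolReal (b : Bool) : ℝ := if b then 1 else 0

namespace BFOP

variable {n m : ℕ} (I : BFOP n m)

/-- The mixed second difference of the `i`-th function. -/
def mixed (i : Fin m) : ℝ :=
  I.func i true true - I.func i true false - I.func i false true + I.func i false false

/-- Two variables interact if some function depends on them in a non-additive way. -/
def Interact (u v : Fin n) : Prop :=
  u ≠ v ∧ ∃ i, I.mixed i ≠ 0 ∧ (I.scope i = (u, v) ∨ I.scope i = (v, u))

/-- The coefficient of the weight `w i` in the change of the slope in direction `v` if the other
variables change by `d`. -/
def coef (v : Fin n) (d : Fin n → ℝ) (i : Fin m) : ℝ :=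
  I.mixed i * if (I.scope i).1 = v then (if (I.scope i).2 = v then 0 else d (I.scope i).2)
    else if (I.scope i).2 = v then d (I.scope i).1 else 0

/-- The difference of the objective between the two values of the variable `v`. -/
def slope (w : Fin m → ℝ) (v : Fin n) (x : Assignment n) : ℝ :=
  I.objective w (Function.update x v true) - I.objective w (Function.update x v false)

variable {I}

lemma Interact.symm {u v : Fin n} (h : I.Interact u v) : I.Interact v u := by
  obtain ⟨h1, i, h2, h3⟩ := h
  exact ⟨h1.symm, i, h2, h3.symm⟩

/-- Additive parts of a function contribute the same to both slopes and cancel, as do functions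
applied twice to `v`; only the mixed second difference remains. -/
lemma slope_sub_slope (w : Fin m → ℝ) (v : Fin n) (x y : Assignment n) :
    I.slope w v x - I.slope w v y =
      ∑ i, w i * I.coef v (fun u => boolReal (x u) - boolReal (y u)) i := by
  simp only [slope, objective, ← Finset.sum_sub_distrib]
  refine Finset.sum_congr rfl fun i _ => ?_
  simp only [coef, mixed, ← mul_sub]
  congr 1
  generalize (I.scope i).1 = p
  generalize (I.scope i).2 = q
  by_cases hp : p = v <;> by_cases hq : q = v
  · subst hp; subst hq
    simp
  · subst hp
    simp only [Function.update_self, Function.update_of_ne hq, if_true, if_neg hq]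
    cases x q <;> cases y q <;> simp [boolReal] <;> ring
  · subst hq
    simp only [Function.update_self, Function.update_of_ne hp, if_true, if_neg hp]
    cases x p <;> cases y p <;> simp [boolReal] <;> ring
  · simp [hp, hq]

/-- Hence a code has to reproduce the changes of interacting variables only. -/
lemma coef_congr {v : Fin n} {d d' : Fin n → ℝ} (h : ∀ u, I.Interact v u → d u = d' u) (i : Fin m) :
    I.coef v d i = I.coef v d' i := by
  simp only [coef]
  by_cases h0 : I.mixed i = 0
  · simp [h0]
  · congr 1
    split_ifs with h1 h2 h2
    · rfl
    · exact h _ ⟨fun h => h2 h.symm, i, h0, Or.inl (by rw [← h1])⟩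
    · exact h _ ⟨fun h => h1 h.symm, i, h0, Or.inr (by rw [← h2])⟩
    · rfl

lemma exists_interact_of_slope_ne {w : Fin m → ℝ} {v : Fin n} {x y : Assignment n}
    (h : I.slope w v x ≠ I.slope w v y) : ∃ u, I.Interact v u ∧ x u ≠ y u := by
  by_contra! hc
  apply h
  rw [← sub_eq_zero, slope_sub_slope]
  refine Finset.sum_eq_zero fun i _ => ?_
  rw [coef_congr (d' := 0) fun u hu => by rw [hc u hu]; simp]
  simp [coef]

lemma objective_flipAt_sub (w : Fin m → ℝ) (x : Assignment n) (v : Fin n) :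
    I.objective w (x.flipAt v) - I.objective w x =
      if x v then -I.slope w v x else I.slope w v x := by
  have h : ∀ b, x v = b → Function.update x v b = x := by
    rintro b rfl
    exact Function.update_eq_self v x
  simp only [Assignment.flipAt, slope]
  cases hb : x v
  · rw [h false hb]; simp
  · rw [h true hb]; simp

open Classical in
/-- The trace of a sequence of improving flips. -/
noncomputable def trace [NeZero n] {w : Fin m → ℝ} {τ : ℕ → Assignment n} {L : ℕ}
    (h : ∀ t < L, IsFlipStep (I.objective w) (τ t) (τ (t + 1))) : FlipTrace n where
  σ t := if ht : t < L then (h t ht).1.choose else 0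
  x := τ
  L := L
  adj := I.Interact
  adj_symm := Interact.symm
  adj_ne := fun h => h.1
  step := by
    intro t ht
    simp only [dif_pos ht]
    exact (h t ht).1.choose_spec
  exists_change := by
    intro i j hij hj
    refine exists_interact_of_slope_ne (w := w) ?_
    have hi : i < L := hij.lt.trans hj
    have hs : ∀ t (ht : t < L), τ (t + 1) = (τ t).flipAt (h t ht).1.choose := fun t ht =>
      (h t ht).1.choose_spec
    set σ : ℕ → Fin n := fun t => if ht : t < L then (h t ht).1.choose else 0 with hσ
    have hσs : ∀ t < L, τ (t + 1) = (τ t).flipAt (σ t) := by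
      intro t ht
      simp only [hσ, dif_pos ht]
      exact hs t ht
    have hpos : ∀ t < L, 0 < if τ t (σ t) then -I.slope w (σ t) (τ t) else I.slope w (σ t) (τ t) := by
      intro t ht
      rw [← objective_flipAt_sub, ← hσs t ht]
      exact sub_pos.mpr (h t ht).2
    have hkeep : ∀ t, i + 1 ≤ t → t ≤ j → τ t (σ i) = !(τ i (σ i)) := by
      intro t ht
      induction t, ht using Nat.le_induction with
      | base =>
        intro _
        rw [hσs i hi, Assignment.flipAt, Function.update_self]
      | succ t ht ih =>
        intro htj
        rw [hσs t (by omega), Assignment.flipAt,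
          Function.update_of_ne (hij.ne (by omega) (by omega)).symm, ih (by omega)]
    -- Both flips improve, but the variable has opposite values at `i` and `j`; equal slopes would
    -- have to be both positive and negative.
    have h1 := hpos i hi
    have h2 := hpos j hj
    change I.slope w (σ i) (τ i) ≠ I.slope w (σ i) (τ j)
    rw [← hij.eq, hkeep j hij.lt le_rfl] at h2
    intro heq
    rw [← heq] at h2
    cases hb : τ i (σ i) <;> simp [hb] at h1 h2 <;> linarith

section Trace

variable [NeZero n] {w : Fin m → ℝ} {τ : ℕ → Assignment n} {L : ℕ}
  (h : ∀ t < L, IsFlipStep (I.objective w) (τ t) (τ (t + 1)))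

lemma trace_abs_slope {t : ℕ} (ht : t < L) : |I.slope w ((trace h).σ t) (τ t)| =
    I.objective w (τ (t + 1)) - I.objective w (τ t) := by
  have h1 : τ (t + 1) = (τ t).flipAt ((trace h).σ t) := (trace h).step t ht
  have h2 := (h t ht).2
  rw [← sub_pos, h1] at h2
  rw [h1]
  rw [objective_flipAt_sub] at h2 ⊢
  split_ifs at h2 ⊢ with hb
  · rw [abs_of_neg (by linarith)]
  · rw [abs_of_pos h2]

end Trace

end BFOP

/-! ### Codes for rows and the union bound -/

/-- The change of the variable `u` between the events `p.1` and `p.2`, where each event consists of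
a flipped variable and its value before the flip. -/
noncomputable def eventDiff {n N : ℕ} (ev : Fin N → Fin n × Bool) (p : Fin N × Fin N) (u : Fin n) : ℝ :=
  let F := Finset.univ.filter fun k => p.1 < k ∧ k < p.2 ∧ (ev k).1 = u
  if h : F.Nonempty then boolReal (ev (F.min' h)).2 - boolReal (!(ev (F.max' h)).2) else 0

namespace FlipTrace

variable {n : ℕ} {T : FlipTrace n}

/-- The first and last flips of `u` inside the arc are recorded, so they are also the first and last
events of `u` in between. The value before the first is the value at the start of the arc; the value
after the last is the value at its end. -/
lemma Recorded.eventDiff_eq {S : Finset (ℕ × ℕ)} {E : Finset ℕ} (h : T.Recorded S E) {a : ℕ × ℕ}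
    (ha : a ∈ S) {p : Fin E.card × Fin E.card} (hp1 : E.orderEmbOfFin rfl p.1 = a.1)
    (hp2 : E.orderEmbOfFin rfl p.2 = a.2) {u : Fin n} (hu : T.adj (T.σ a.1) u) :
    eventDiff (fun k => (T.σ (E.orderEmbOfFin rfl k),
      T.x (E.orderEmbOfFin rfl k) (T.σ (E.orderEmbOfFin rfl k)))) p u =
      boolReal (T.x a.1 u) - boolReal (T.x a.2 u) := by
  classical
  set e := E.orderEmbOfFin rfl with he
  have harc := h.isArc a ha
  have ha2 := h.subset _ (h.snd_mem a ha)
  have hne := T.adj_ne hu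
  have hsurj : ∀ t ∈ E, ∃ k, e k = t := by
    intro t ht
    have : t ∈ Set.range e := by rw [he, Finset.range_orderEmbOfFin]; exact ht
    exact this
  have hidx : ∀ k, (p.1 < k ∧ k < p.2) ↔ (a.1 < e k ∧ e k < a.2) := by
    intro k
    rw [← hp1, ← hp2, e.lt_iff_lt, e.lt_iff_lt]
  simp only [eventDiff]
  set F := Finset.univ.filter fun k : Fin E.card => p.1 < k ∧ k < p.2 ∧ T.σ (e k) = u with hF
  have hmemF : ∀ k, k ∈ F ↔ (a.1 < e k ∧ e k < a.2) ∧ T.σ (e k) = u := by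
    intro k
    rw [← hidx, hF, Finset.mem_filter]
    simp [and_assoc]
  by_cases hflip : ∃ t, (a.1 < t ∧ t < a.2) ∧ T.σ t = u
  · set B := (Finset.Ioo a.1 a.2).filter fun t => T.σ t = u with hB
    have hmemB : ∀ t, t ∈ B ↔ (a.1 < t ∧ t < a.2) ∧ T.σ t = u := by
      intro t; rw [hB, Finset.mem_filter, Finset.mem_Ioo]
    obtain ⟨t, ht⟩ := hflip
    have hBne : B.Nonempty := ⟨t, (hmemB t).mpr ht⟩
    obtain ⟨⟨f1, f2⟩, f3⟩ := (hmemB _).mp (B.min'_mem hBne)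
    obtain ⟨⟨l1, l2⟩, l3⟩ := (hmemB _).mp (B.max'_mem hBne)
    have hbefore : ∀ s, a.1 < s → s < B.min' hBne → T.σ s ≠ u := fun s hs1 hs2 hs3 =>
      absurd (B.min'_le s ((hmemB s).mpr ⟨⟨hs1, by omega⟩, hs3⟩)) (by omega)
    have hafter : ∀ s, B.max' hBne < s → s < a.2 → T.σ s ≠ u := fun s hs1 hs2 hs3 =>
      absurd (B.le_max' s ((hmemB s).mpr ⟨⟨by omega, hs2⟩, hs3⟩)) (by omega)
    obtain ⟨k1, hk1⟩ := hsurj _ (h.first_mem a ha _ f1 f2 (by rwa [f3]) (by rwa [f3]))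
    obtain ⟨k2, hk2⟩ := hsurj _ (h.last_mem a ha _ l1 l2 (by rwa [l3]) (by rwa [l3]))
    have hk1F : k1 ∈ F := by rw [hmemF, hk1]; exact ⟨⟨f1, f2⟩, f3⟩
    have hk2F : k2 ∈ F := by rw [hmemF, hk2]; exact ⟨⟨l1, l2⟩, l3⟩
    have hFne : F.Nonempty := ⟨k1, hk1F⟩
    have hmin : F.min' hFne = k1 := by
      refine le_antisymm (F.min'_le _ hk1F) (F.le_min' _ _ fun k hk => ?_)
      rw [← e.le_iff_le, hk1]
      exact B.min'_le _ ((hmemB _).mpr ((hmemF k).mp hk))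
    have hmax : F.max' hFne = k2 := by
      refine le_antisymm (F.max'_le _ _ fun k hk => ?_) (F.le_max' _ hk2F)
      rw [← e.le_iff_le, hk2]
      exact B.le_max' _ ((hmemB _).mpr ((hmemF k).mp hk))
    rw [dif_pos hFne, hmin, hmax, hk1, hk2, f3, l3]
    congr 2
    · refine (T.x_eq f1.le (by omega) fun s hs1 hs2 => ?_).symm
      rcases hs1.eq_or_lt with rfl | hs
      · exact hne
      · exact hbefore s hs hs2
    · have h3 := T.x_succ (t := B.max' hBne) (by omega)
      rw [l3] at h3
      rw [← h3]
      exact T.x_eq l2 ha2.le fun s hs1 hs2 => hafter s hs1 hs2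
  · have hFe : ¬ F.Nonempty := by
      rintro ⟨k, hk⟩
      exact hflip ⟨e k, (hmemF k).mp hk⟩
    rw [dif_neg hFe, T.x_eq harc.lt.le ha2.le (u := u), sub_self]
    intro s hs1 hs2 hs3
    rcases hs1.eq_or_lt with rfl | hs
    · exact hne hs3
    · exact hflip ⟨s, ⟨hs, hs2⟩, hs3⟩

end FlipTrace

/-- A description of `r` rows by `N` events and the pairs of events at the ends of each row. -/
abbrev FlipCode (n r N : ℕ) : Type := (Fin N → Fin n × Bool) × (Fin r → Fin N × Fin N)

namespace BFOP

variable {n m : ℕ} (I : BFOP n m)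

/-- The linear form in the weights described by the row `a` of a code. -/
noncomputable def rowCoef {r N : ℕ} (c : FlipCode n r N) (a : Fin r) : Fin m → ℝ :=
  I.coef (c.1 (c.2 a).1).1 (eventDiff c.1 (c.2 a))

/-- The rows of the code are in triangular form, with pivots of absolute value at least `κ`. -/
def IsTriangularCode (κ : ℝ) {r N : ℕ} (c : FlipCode n r N) : Prop :=
  ∃ col : Fin r → Fin m, (∀ a, κ ≤ |I.rowCoef c a (col a)|) ∧
    ∀ S : Finset (Fin r), S.Nonempty → ∃ a ∈ S, ∀ b ∈ S, b ≠ a → I.rowCoef c b (col a) = 0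

/-- The weights for which the linear forms of some triangular code are all at most `δ`. -/
def smallForms (κ δ : ℝ) (L q : ℕ) : Set (Fin m → ℝ) :=
  ⋃ r ∈ Finset.Icc 1 L, ⋃ N ∈ (Finset.range (L + 1)).filter (· ≤ q * r),
    ⋃ c : {c : FlipCode n r N // I.IsTriangularCode κ c},
      {w | ∀ a, |∑ i, w i * I.rowCoef c.1 a i| ≤ δ}

variable {I}

lemma measurableSet_smallForms (κ δ : ℝ) (L q : ℕ) : MeasurableSet (I.smallForms κ δ L q) := by
  refine Finset.measurableSet_biUnion _ fun r _ => Finset.measurableSet_biUnion _ fun N _ =>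
    MeasurableSet.iUnion fun c => ?_
  simp only [Set.ofPred_forall]
  exact MeasurableSet.iInter fun a => measurableSet_le (by fun_prop) (by fun_prop)

lemma coef_ne {v u : Fin n} {i : Fin m} (huv : v ≠ u) (hi : I.scope i = (v, u) ∨ I.scope i = (u, v))
    (d : Fin n → ℝ) : I.coef v d i = I.mixed i * d u := by
  rcases hi with hi | hi <;> simp [coef, hi, huv.symm]

lemma coef_eq_zero {v p q : Fin n} {i : Fin m} (hi : I.scope i = (p, q) ∨ I.scope i = (q, p))
    {d : Fin n → ℝ} (h1 : v = p → d q = 0) (h2 : v = q → d p = 0) : I.coef v d i = 0 := by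
  rcases hi with hi | hi <;> simp only [coef, hi] <;> split_ifs with h3 h4 h4 <;> simp_all

/-- The trace depends on the weights, but the exceptional set is a union over all codes, fixed
before the draw. The bound `2 * ε` is the sum of the slopes at the two ends of an arc. -/
lemma mem_smallForms_of_recorded {κ ε : ℝ} {w : Fin m → ℝ} {q : ℕ} {T : FlipTrace n}
    (hκ : ∀ i, I.mixed i ≠ 0 → κ ≤ |I.mixed i|) (hadj : T.adj = I.Interact)
    (hslope : ∀ t < T.L, |I.slope w (T.σ t) (T.x t)| ≤ ε)
    {S : Finset (ℕ × ℕ)} {E : Finset ℕ} {piv : ℕ × ℕ → Fin n} (hne : S.Nonempty)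
    (htri : T.Triangular S piv) (hrec : T.Recorded S E) (hcard : E.card ≤ q * S.card) :
    w ∈ I.smallForms κ (2 * ε) T.L q := by
  classical
  set e := E.orderEmbOfFin rfl with he
  have hsurj : ∀ t : ℕ, ∃ k, t ∈ E → e k = t := by
    intro t
    by_cases h : t ∈ E
    · have : t ∈ Set.range e := by rw [he, Finset.range_orderEmbOfFin]; exact h
      obtain ⟨k, hk⟩ := this
      exact ⟨k, fun _ => hk⟩
    -- A default index for times outside `E`, which exists because `E` is nonempty.
    · obtain ⟨a, ha⟩ := hne
      exact ⟨⟨0, Finset.card_pos.mpr ⟨_, hrec.fst_mem a ha⟩⟩, fun h' => absurd h' h⟩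
  choose idx hidx using hsurj
  set s := S.equivFin.symm with hs
  have hfst : ∀ a, e (idx (s a).1.1) = (s a).1.1 := fun a => hidx _ (hrec.fst_mem _ (s a).2)
  have hsnd : ∀ a, e (idx (s a).1.2) = (s a).1.2 := fun a => hidx _ (hrec.snd_mem _ (s a).2)
  set c : FlipCode n S.card E.card := (fun k => (T.σ (e k), T.x (e k) (T.σ (e k))),
    fun a => (idx (s a).1.1, idx (s a).1.2)) with hc
  set d : ℕ × ℕ → Fin n → ℝ := fun a u => boolReal (T.x a.1 u) - boolReal (T.x a.2 u) with hd
  have hrow : ∀ a i, I.rowCoef c a i = I.coef (T.σ (s a).1.1) (d (s a).1) i := by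
    intro a i
    simp only [rowCoef, hc, hfst]
    refine coef_congr (fun u hu => ?_) i
    exact hrec.eventDiff_eq (s a).2 (hfst a) (hsnd a) (by rw [hadj]; exact hu)
  have hint : ∀ a, I.Interact (T.σ (s a).1.1) (piv (s a).1) := fun a => by
    rw [← hadj]; exact htri.adj _ (s a).2
  choose hneq col hcol hscope using hint
  have hcode : I.IsTriangularCode κ c := by
    refine ⟨col, fun a => ?_, fun S' hS' => ?_⟩
    · rw [hrow, coef_ne (hneq a) (hscope a), abs_mul]
      have h1 : |d (s a).1 (piv (s a).1)| = 1 := by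
        have := htri.ne _ (s a).2
        simp only [hd]
        cases h1 : T.x (s a).1.1 (piv (s a).1) <;> cases h2 : T.x (s a).1.2 (piv (s a).1) <;>
          simp_all [boolReal]
      rw [h1, mul_one]
      exact hκ _ (hcol a)
    · obtain ⟨a, ha, hb⟩ := htri.exists_pivot (S'.image fun a => (s a).1) (fun a ha => by
        obtain ⟨b, -, rfl⟩ := Finset.mem_image.mp ha
        exact (s b).2) (hS'.image _)
      obtain ⟨a', ha', rfl⟩ := Finset.mem_image.mp ha
      refine ⟨a', ha', fun b hbS hba => ?_⟩
      have h1 := hb _ (Finset.mem_image_of_mem _ hbS) fun h => hba (s.injective (Subtype.ext h))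
      simp only [FlipTrace.Involves, not_or, not_and, not_not] at h1
      rw [hrow]
      refine coef_eq_zero (hscope a') (fun h => ?_) fun h => ?_
      · simp only [hd, h1.1 h, sub_self]
      · simp only [hd, h1.2 h, sub_self]
  have hS : S ⊆ T.arcs := fun a ha => FlipTrace.mem_arcs.mpr
    ⟨hrec.isArc a ha, hrec.subset _ (hrec.snd_mem a ha)⟩
  simp only [smallForms, Set.mem_iUnion]
  refine ⟨S.card, ?_, E.card, ?_, ⟨c, hcode⟩, fun a => ?_⟩
  · rw [Finset.mem_Icc]
    exact ⟨Finset.card_pos.mpr hne, (Finset.card_le_card hS).trans FlipTrace.card_arcs_le⟩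
  · rw [Finset.mem_filter, Finset.mem_range]
    have : E ⊆ Finset.range T.L := fun t ht => Finset.mem_range.mpr (hrec.subset t ht)
    have := Finset.card_le_card this
    rw [Finset.card_range] at this
    exact ⟨by omega, hcard⟩
  · simp only [hrow, hd]
    rw [← slope_sub_slope]
    have harc := hrec.isArc _ (s a).2
    have h2 := hrec.subset _ (hrec.snd_mem _ (s a).2)
    have h3 := hslope _ (harc.lt.trans h2)
    have h4 := hslope _ h2
    rw [← harc.eq] at h4
    rw [abs_le] at h3 h4 ⊢
    constructor <;> linarith

/-- Outside of the exceptional set, one of any `L` consecutive flips is a large improvement. -/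
lemma exists_large_step [NeZero n] {κ ε : ℝ} {w : Fin m → ℝ} {D L : ℕ} (hD : 2 ≤ D)
    (hn : 4 * n ≤ 2 ^ (D ^ 2)) (hL : 2 ^ (D ^ 2 + D) ≤ L)
    (hκ : ∀ i, I.mixed i ≠ 0 → κ ≤ |I.mixed i|)
    (hw : w ∉ I.smallForms κ (2 * ε) L (1024 * D)) {τ : ℕ → Assignment n}
    (h : ∀ t < L, IsFlipStep (I.objective w) (τ t) (τ (t + 1))) :
    ∃ t < L, ε < I.objective w (τ (t + 1)) - I.objective w (τ t) := by
  by_contra! hc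
  obtain ⟨S, E, piv, hne, htri, hrec, hcard⟩ :=
    (trace h).exists_triangular_recorded hD hn hL
  refine hw (mem_smallForms_of_recorded (T := trace h) hκ rfl (fun t ht => ?_) hne htri hrec hcard)
  exact (trace_abs_slope h ht).trans_le (hc t ht)

lemma abs_objective_le {w : Fin m → ℝ} (hw : ∀ i, |w i| ≤ 1) {M : ℝ}
    (hM : ∀ i a b, |I.func i a b| ≤ M) (τ : Assignment n) : |I.objective w τ| ≤ m * M := by
  refine (Finset.abs_sum_le_sum_abs _ _).trans ?_
  refine (Finset.sum_le_card_nsmul _ _ M fun i _ => ?_).trans (by simp)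
  rw [abs_mul]
  exact (mul_le_of_le_one_left (abs_nonneg _) (hw i)).trans (hM _ _ _)

/-- Each full block of `L` flips gains at least `ε`, the objective stays in an interval of length `2
* (m * M)`, and the last block may be incomplete. -/
lemma steps_le [NeZero n] {κ ε M : ℝ} {w : Fin m → ℝ} {D L : ℕ} (hD : 2 ≤ D)
    (hn : 4 * n ≤ 2 ^ (D ^ 2)) (hL : 2 ^ (D ^ 2 + D) ≤ L)
    (hκ : ∀ i, I.mixed i ≠ 0 → κ ≤ |I.mixed i|) (hε : 0 < ε) (hw1 : ∀ i, |w i| ≤ 1)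
    (hM : ∀ i a b, |I.func i a b| ≤ M)
    (hw : w ∉ I.smallForms κ (2 * ε) L (1024 * D)) :
    FlipTerminatesWithin (I.objective w) (L * (2 * (m * M) / ε + 1)) := by
  intro ℓ τ h
  have hmono : ∀ s t, s ≤ t → t ≤ ℓ → I.objective w (τ s) ≤ I.objective w (τ t) := by
    intro s t hst
    induction t, hst using Nat.le_induction with
    | base => intro _; exact le_rfl
    | succ t _ ih => exact fun ht => (ih (by omega)).trans (h t (by omega)).2.le
  have hblock : ∀ b : ℕ, b * L ≤ ℓ → b * ε ≤ I.objective w (τ (b * L)) - I.objective w (τ 0) := by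
    intro b
    induction b with
    | zero => intro _; simp
    | succ b ih =>
      intro hb
      rw [Nat.succ_mul] at hb
      obtain ⟨t, ht, hlt⟩ := exists_large_step (τ := fun t => τ (b * L + t)) hD hn hL hκ hw
        fun t ht => h (b * L + t) (by omega)
      have h1 := ih (by omega)
      have h2 := hmono (b * L) (b * L + t) (by omega) (by omega)
      have h3 := hmono (b * L + (t + 1)) ((b + 1) * L) (by rw [Nat.succ_mul]; omega)
        (by rw [Nat.succ_mul]; omega)
      push_cast
      linarith
  have hLpos : 0 < L := lt_of_lt_of_le (by positivity) hL
  have h1 := hblock (ℓ / L) (Nat.div_mul_le_self ℓ L)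
  have h2 := abs_objective_le hw1 hM (τ (ℓ / L * L))
  have h3 := abs_objective_le hw1 hM (τ 0)
  rw [abs_le] at h2 h3
  have h4 : ((ℓ / L : ℕ) : ℝ) ≤ 2 * (m * M) / ε := by
    rw [le_div_iff₀ hε]
    linarith
  have h5 : ℓ < L * (ℓ / L + 1) := Nat.lt_mul_div_succ ℓ hLpos
  calc (ℓ : ℝ) ≤ L * ((ℓ / L : ℕ) + 1 : ℝ) := by exact_mod_cast h5.le
    _ ≤ _ := by gcongr

/-- There are at most `((2 * n) ^ q * L ^ 2) ^ r` codes with `r` rows, and `hδ` outweighs each row's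
share with a factor `Z` to spare. The prefactor counts the pairs `(r, N)`. -/
lemma measure_smallForms_le {φ κ δ : ℝ} {μ : Fin m → Measure ℝ}
    (hμ : ∀ i, IsSmoothWeightLaw φ (μ i)) (hκ : 0 < κ) {L q Z : ℕ} (hn : 0 < n)
    (hZ : (2 * n) ^ q * L ^ 2 * Z ≠ 0)
    (hδ : ENNReal.ofReal φ * ENNReal.ofReal (2 * δ / κ) ≤
      (((2 * n) ^ q * L ^ 2 * Z : ℕ) : ℝ≥0∞)⁻¹) :
    Measure.pi μ (I.smallForms κ δ L q) ≤ (L * (L + 1) : ℕ) * (Z : ℝ≥0∞)⁻¹ := by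
  classical
  have hcode : ∀ r ∈ Finset.Icc 1 L, ∀ N ∈ (Finset.range (L + 1)).filter (· ≤ q * r),
      Measure.pi μ (⋃ c : {c : FlipCode n r N // I.IsTriangularCode κ c},
        {w | ∀ a, |∑ i, w i * I.rowCoef c.1 a i| ≤ δ}) ≤ (Z : ℝ≥0∞)⁻¹ := by
    intro r hr N hN
    rw [Finset.mem_Icc] at hr
    rw [Finset.mem_filter, Finset.mem_range] at hN
    have hc : ∀ c : {c : FlipCode n r N // I.IsTriangularCode κ c},
        Measure.pi μ {w | ∀ a, |∑ i, w i * I.rowCoef c.1 a i| ≤ δ} ≤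
          ((((2 * n) ^ q * L ^ 2 * Z : ℕ) : ℝ≥0∞)⁻¹) ^ r := by
      rintro ⟨c, col, h1, h2⟩
      have := pi_measure_forms_le hμ hκ (δ := δ) (I.rowCoef c) col Finset.univ (fun a _ => h1 a)
        fun S _ => h2 S
      simp only [Finset.mem_univ, true_imp_iff, Finset.card_univ, Fintype.card_fin] at this
      exact this.trans (pow_le_pow_left' hδ r)
    have hcard : Fintype.card {c : FlipCode n r N // I.IsTriangularCode κ c} ≤
        ((2 * n) ^ q * L ^ 2) ^ r := by
      refine (Fintype.card_subtype_le _).trans ?_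
      simp only [FlipCode, Fintype.card_prod, Fintype.card_fun, Fintype.card_fin, Fintype.card_bool]
      calc (n * 2) ^ N * (N * N) ^ r ≤ (n * 2) ^ (q * r) * (L * L) ^ r := by
            gcongr <;> omega
        _ = _ := by rw [pow_mul, ← mul_pow, mul_comm n 2, sq]
    calc _ ≤ ∑ c : {c : FlipCode n r N // I.IsTriangularCode κ c},
          Measure.pi μ {w | ∀ a, |∑ i, w i * I.rowCoef c.1 a i| ≤ δ} :=
          measure_iUnion_fintype_le _ _
      _ ≤ ∑ _c : {c : FlipCode n r N // I.IsTriangularCode κ c},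
          ((((2 * n) ^ q * L ^ 2 * Z : ℕ) : ℝ≥0∞)⁻¹) ^ r := Finset.sum_le_sum fun c _ => hc c
      _ = Fintype.card {c : FlipCode n r N // I.IsTriangularCode κ c} *
          ((((2 * n) ^ q * L ^ 2 * Z : ℕ) : ℝ≥0∞)⁻¹) ^ r := by simp
      _ ≤ (((2 * n) ^ q * L ^ 2) ^ r : ℕ) *
          ((((2 * n) ^ q * L ^ 2 * Z : ℕ) : ℝ≥0∞)⁻¹) ^ r := by gcongr
      _ = ((Z : ℝ≥0∞)⁻¹) ^ r := by
          have hA : (2 * n) ^ q * L ^ 2 ≠ 0 := left_ne_zero_of_mul hZ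
          generalize (2 * n) ^ q * L ^ 2 = A at *
          rw [Nat.cast_pow, ← mul_pow, Nat.cast_mul, ENNReal.mul_inv (by simp [hA]) (by simp),
            ← mul_assoc, ENNReal.mul_inv_cancel (by simp [hA]) (by simp), one_mul]
      -- One factor `Z⁻¹` is available because there is at least one row.
      _ ≤ ((Z : ℝ≥0∞)⁻¹) ^ 1 := by
          refine pow_le_pow_right_of_le_one' ?_ hr.1
          have hZ0 : Z ≠ 0 := right_ne_zero_of_mul hZ
          rw [ENNReal.inv_le_one]
          exact_mod_cast Nat.one_le_iff_ne_zero.mpr hZ0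
      _ = _ := pow_one _
  refine (measure_biUnion_finset_le _ _).trans ?_
  calc _ ≤ ∑ r ∈ Finset.Icc 1 L, ((L + 1 : ℕ) : ℝ≥0∞) * (Z : ℝ≥0∞)⁻¹ := by
        refine Finset.sum_le_sum fun r hr => (measure_biUnion_finset_le _ _).trans ?_
        refine (Finset.sum_le_sum (hcode r hr)).trans ?_
        rw [Finset.sum_const, nsmul_eq_mul]
        gcongr
        exact (Finset.card_filter_le _ _).trans (Finset.card_range _).le
    _ = _ := by
        rw [Finset.sum_const, Nat.card_Icc, nsmul_eq_mul, ← mul_assoc]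
        simp

end BFOP

/-! ### Choice of parameters and the quantitative bound -/

lemma pi_measure_unit_cube {m : ℕ} {φ : ℝ} {μ : Fin m → Measure ℝ}
    (hμ : ∀ i, IsSmoothWeightLaw φ (μ i)) :
    Measure.pi μ {w : Fin m → ℝ | ∀ i, |w i| ≤ 1}ᶜ = 0 := by
  have hprob : ∀ i, IsProbabilityMeasure (μ i) := fun i => (hμ i).isProbabilityMeasure
  have h1 : {w : Fin m → ℝ | ∀ i, |w i| ≤ 1} = Set.univ.pi fun _ => Set.Icc (-1) 1 := by
    ext w
    simp only [Set.mem_ofPred_eq, abs_le, Set.mem_pi, Set.mem_univ, true_imp_iff, Set.mem_Icc]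
  rw [h1, prob_compl_eq_zero_iff (MeasurableSet.univ_pi fun _ => measurableSet_Icc), Measure.pi_pi]
  exact Finset.prod_eq_one fun i _ =>
    (prob_compl_eq_zero_iff measurableSet_Icc).mp (hμ i).supported

/-- The number of scales, the length of a block of flips, and the inverse of the gain per block are
governed by this approximation of `√(log n)`. -/
def sqrtLog (n : ℕ) : ℕ := Nat.sqrt (Nat.log 2 n) + 2

lemma two_le_sqrtLog (n : ℕ) : 2 ≤ sqrtLog n := Nat.le_add_left _ _

lemma four_mul_le_two_pow_sqrtLog (n : ℕ) : 4 * n ≤ 2 ^ (sqrtLog n ^ 2) := by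
  have h1 : n < 2 ^ (Nat.log 2 n + 1) := Nat.lt_pow_succ_log_self (by norm_num) n
  have h2 : Nat.log 2 n + 3 ≤ sqrtLog n ^ 2 := by
    have := Nat.lt_succ_sqrt' (Nat.log 2 n)
    simp only [sqrtLog, Nat.succ_eq_add_one] at *
    generalize Nat.sqrt (Nat.log 2 n) = s at *
    nlinarith [Nat.zero_le s]
  calc 4 * n ≤ 4 * 2 ^ (Nat.log 2 n + 1) := by omega
    _ = 2 ^ (Nat.log 2 n + 3) := by ring
    _ ≤ _ := Nat.pow_le_pow_right (by norm_num) h2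

lemma sqrtLog_le {n : ℕ} (hn : 2 ≤ n) : (sqrtLog n : ℝ) ≤ 5 * √(Real.log n) := by
  have hl2 : 0.69 < Real.log 2 := by linarith [Real.log_two_gt_d9]
  have h1 : Real.log 2 ≤ Real.log n := Real.log_le_log (by norm_num) (by exact_mod_cast hn)
  have h2 : (Nat.log 2 n : ℝ) * Real.log 2 ≤ Real.log n := by
    rw [← Real.log_pow]
    refine Real.log_le_log (by positivity) ?_
    exact_mod_cast Nat.pow_log_le_self 2 (by omega)
  have h3 : ((Nat.sqrt (Nat.log 2 n) : ℕ) : ℝ) ≤ 2 * √(Real.log n) := by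
    have h4 : ((Nat.sqrt (Nat.log 2 n) : ℕ) : ℝ) ^ 2 ≤ Nat.log 2 n := by
      exact_mod_cast Nat.sqrt_le' _
    have h5 : ((Nat.sqrt (Nat.log 2 n) : ℕ) : ℝ) ≤ √(4 * Real.log n) :=
      Real.le_sqrt_of_sq_le (by nlinarith [(Nat.log 2 n).cast_nonneg (α := ℝ)])
    rwa [show (4 : ℝ) = 2 ^ 2 by norm_num, Real.sqrt_mul (by norm_num), Real.sqrt_sq (by norm_num)]
      at h5
  have h6 : (2 : ℝ) ≤ 3 * √(Real.log n) := by
    have : (2 / 3 : ℝ) ≤ √(Real.log n) := Real.le_sqrt_of_sq_le (by norm_num; linarith)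
    linarith
  simp only [sqrtLog]
  push_cast
  linarith

/-- The cube of `5 * √(log n)` is `log n` times `125 * √(log n)`, and the factor `log n` turns the
base into `n`. -/
lemma two_pow_sqrtLog_le {n : ℕ} (hn : 2 ≤ n) (c : ℕ) :
    (2 : ℝ) ^ (c * sqrtLog n ^ 3) ≤ (n : ℝ) ^ ((125 * c : ℝ) * √(Real.log n)) := by
  have hn0 : (0 : ℝ) < n := by positivity
  have hl : 0 ≤ Real.log n := Real.log_natCast_nonneg n
  have hl2 : Real.log 2 ≤ 1 := by linarith [Real.log_two_lt_d9]
  rw [Real.rpow_def_of_pos hn0, ← Real.rpow_natCast, Real.rpow_def_of_pos (by norm_num),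
    Real.exp_le_exp]
  have h1 : (sqrtLog n : ℝ) ^ 3 ≤ (5 * √(Real.log n)) ^ 3 :=
    pow_le_pow_left₀ (by positivity) (sqrtLog_le hn) 3
  push_cast
  calc Real.log 2 * (c * (sqrtLog n : ℝ) ^ 3) ≤ 1 * (c * (5 * √(Real.log n)) ^ 3) := by gcongr
    _ = √(Real.log n) ^ 2 * (125 * c * √(Real.log n)) := by ring
    _ = _ := by rw [Real.sq_sqrt hl]

namespace BFOP

variable {n m : ℕ}

/-- The step gain `ε = κ / (4 * φ * Z)` makes the probability bound for a single form equal to `1 /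
Z`; the factor `n * (L * (L + 1))` in `Z` leaves failure probability `1 / n`. -/
lemma flipFastWithProb_of_le {I : BFOP n m} {φ κ M T : ℝ} {μ : Fin m → Measure ℝ} (hn : 2 ≤ n)
    (hφ : 0 < φ) (hμ : ∀ i, IsSmoothWeightLaw φ (μ i)) (hκ0 : 0 < κ)
    (hκ : ∀ i, I.mixed i ≠ 0 → κ ≤ |I.mixed i|) (hM : ∀ i a b, |I.func i a b| ≤ M) {D L Z : ℕ}
    (hD : 2 ≤ D) (hDn : 4 * n ≤ 2 ^ (D ^ 2)) (hL : 2 ^ (D ^ 2 + D) ≤ L)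
    (hZ : Z = (2 * n) ^ (1024 * D) * L ^ 2 * (n * (L * (L + 1))))
    (hT : L * (2 * (m * M) / (κ / (4 * φ * Z)) + 1) ≤ T) :
    FlipFastWithProb I.objective μ T (1 - 2 / (n + 1)) := by
  have : NeZero n := ⟨by omega⟩
  have hprob : ∀ i, IsProbabilityMeasure (μ i) := fun i => (hμ i).isProbabilityMeasure
  have hLpos : 0 < L := lt_of_lt_of_le (by positivity) hL
  have hZpos : 0 < Z := by rw [hZ]; positivity
  have hZpos' : (0 : ℝ) < Z := by exact_mod_cast hZpos
  set ε := κ / (4 * φ * Z) with hε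
  have hε0 : 0 < ε := by positivity
  set B := I.smallForms κ (2 * ε) L (1024 * D) with hB
  set Q := {w : Fin m → ℝ | ∀ i, |w i| ≤ 1} with hQ
  have hBm : MeasurableSet B := measurableSet_smallForms _ _ _ _
  have hBle : Measure.pi μ B ≤ (n : ℝ≥0∞)⁻¹ := by
    refine (measure_smallForms_le hμ hκ0 (by omega) (by rw [← hZ]; omega) ?_).trans ?_
    · rw [← hZ, ← ENNReal.ofReal_mul hφ.le,
        show φ * (2 * (2 * ε) / κ) = (Z : ℝ)⁻¹ by rw [hε]; field_simp; norm_num,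
        ENNReal.ofReal_inv_of_pos hZpos', ENNReal.ofReal_natCast]
    · have h0 : L * (L + 1) ≠ 0 := by positivity
      generalize L * (L + 1) = A at *
      rw [Nat.cast_mul, ENNReal.mul_inv (by simp) (by simp), mul_comm, mul_assoc,
        ENNReal.inv_mul_cancel (by simpa using h0) (by simp), mul_one]
  have hsub : (B ∪ Qᶜ)ᶜ ⊆ {w | FlipTerminatesWithin (I.objective w) T} := by
    intro w hw
    simp only [Set.compl_union, compl_compl, Set.mem_inter_iff, Set.mem_compl_iff] at hw
    exact fun ℓ τ h => (steps_le hD hDn hL hκ hε0 hw.2 hM hw.1 ℓ τ h).trans hT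
  have hQm : MeasurableSet Q := by
    simp only [hQ, Set.ofPred_forall]
    exact MeasurableSet.iInter fun i => measurableSet_le (by fun_prop) (by fun_prop)
  have hbad : (Measure.pi μ).real (B ∪ Qᶜ) ≤ (n : ℝ)⁻¹ := by
    have h1 : Measure.pi μ (B ∪ Qᶜ) ≤ (n : ℝ≥0∞)⁻¹ := by
      refine (measure_union_le _ _).trans ?_
      rw [pi_measure_unit_cube hμ, add_zero]
      exact hBle
    have h2 := ENNReal.toReal_mono (by simp; omega) h1
    simpa [Measure.real] using h2
  have hgood : 1 - (n : ℝ)⁻¹ ≤ (Measure.pi μ).real {w | FlipTerminatesWithin (I.objective w) T} := by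
    refine le_trans ?_ (measureReal_mono hsub)
    rw [probReal_compl_eq_one_sub (hBm.union hQm.compl)]
    linarith
  refine le_trans ?_ hgood
  have hn' : (2 : ℝ) ≤ n := by exact_mod_cast hn
  have : (n : ℝ)⁻¹ ≤ 2 / (n + 1) := by
    rw [inv_eq_one_div, div_le_div_iff₀ (by positivity) (by positivity)]
    linarith
  linarith

/-- With high probability FLIP is fast, if the nonzero mixed differences are not too small relative
to the function values. -/
theorem exists_flipFastWithProb (K d : ℕ) : ∃ C : ℝ, ∀ (n m : ℕ) (I : BFOP n m) (φ : ℝ)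
    (μ : Fin m → Measure ℝ) (κ M : ℝ), 0 < φ → (∀ i, IsSmoothWeightLaw φ (μ i)) → 0 < κ →
    (∀ i, I.mixed i ≠ 0 → κ ≤ |I.mixed i|) → (∀ i a b, |I.func i a b| ≤ M) →
    M ≤ K * n ^ d * κ →
    FlipFastWithProb I.objective μ (φ * m * (n : ℝ) ^ (C * √(Real.log n))) (1 - 2 / (n + 1)) := by
  refine ⟨125 * (1040 + K + d : ℕ), fun n m I φ μ κ M hφ hμ hκ0 hκ hM hMK => ?_⟩
  -- For `n < 2` the allowed failure probability is at least `1`.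
  rcases lt_or_ge n 2 with hn | hn
  · refine le_trans ?_ measureReal_nonneg
    have : (n : ℝ) ≤ 1 := by exact_mod_cast Nat.lt_succ_iff.mp hn
    have : (1 : ℝ) ≤ 2 / (n + 1) := by
      rw [le_div_iff₀ (by positivity)]
      linarith
    linarith
  set D := sqrtLog n with hD
  have hD2 : 2 ≤ D := two_le_sqrtLog n
  have hDn : 4 * n ≤ 2 ^ (D ^ 2) := four_mul_le_two_pow_sqrtLog n
  set L := 2 ^ (D ^ 2 + D) with hL
  set Z := (2 * n) ^ (1024 * D) * L ^ 2 * (n * (L * (L + 1))) with hZ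
  rcases Nat.eq_zero_or_pos m with rfl | hm
  · have hall : {w : Fin 0 → ℝ | FlipTerminatesWithin (I.objective w)
        (φ * (0 : ℕ) * (n : ℝ) ^ ((125 * (1040 + K + d : ℕ) : ℝ) * √(Real.log n)))} = Set.univ := by
      refine Set.eq_univ_of_forall fun w ℓ τ h => ?_
      rcases Nat.eq_zero_or_pos ℓ with rfl | hℓ
      · simp
      -- Without functions the objective is constant and no flip improves it.
      · exact absurd (h 0 hℓ).2 (by simp [objective])
    rw [FlipFastWithProb, hall]
    have : (0 : ℝ) ≤ 2 / (n + 1) := by positivity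
    simpa [Measure.real] using this
  refine flipFastWithProb_of_le hn hφ hμ hκ0 hκ hM hD2 hDn hL.ge hZ ?_
  have hLle : L ≤ 2 ^ (D ^ 3) := by
    refine Nat.pow_le_pow_right (by norm_num) ?_
    nlinarith [Nat.mul_le_mul hD2 hD2, Nat.mul_le_mul hD2 (Nat.mul_le_mul hD2 hD2)]
  have hnle : n ≤ 2 ^ (D ^ 3) := by
    have : 2 ^ (D ^ 2) ≤ 2 ^ (D ^ 3) := Nat.pow_le_pow_right (by norm_num)
      (Nat.pow_le_pow_right (by omega) (by norm_num))
    omega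
  set X := 2 ^ (D ^ 3) with hX
  have hX2 : 8 ≤ X := by
    calc 8 ≤ 2 ^ (2 ^ 3) := by norm_num
      _ ≤ _ := Nat.pow_le_pow_right (by norm_num) (Nat.pow_le_pow_left hD2 3)
  -- The exponent is `1024` for the events, `2` for `L ^ 2`, and `4` for `n * (L * (L + 1))` with `L
  -- + 1 ≤ X * X`.
  have hZle : Z ≤ X ^ 1030 := by
    have h1 : (2 * n) ^ (1024 * D) ≤ X ^ 1024 := by
      calc (2 * n) ^ (1024 * D) ≤ (2 ^ (D ^ 2)) ^ (1024 * D) := Nat.pow_le_pow_left (by omega) _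
        _ = X ^ 1024 := by
            rw [hX, ← pow_mul, ← pow_mul, show D ^ 2 * (1024 * D) = D ^ 3 * 1024 by ring]
    calc Z ≤ X ^ 1024 * X ^ 2 * (X * (X * (X * X))) := by
          rw [hZ]
          gcongr
          nlinarith
      _ = _ := by ring
  have hKX : K ≤ X ^ K := (Nat.lt_two_pow_self (n := K)).le.trans (Nat.pow_le_pow_left (by omega) K)
  have hXle : (X : ℝ) ^ (1040 + K + d) ≤
      (n : ℝ) ^ ((125 * (1040 + K + d : ℕ) : ℝ) * √(Real.log n)) := by
    refine le_trans (le_of_eq ?_) (two_pow_sqrtLog_le hn (1040 + K + d))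
    rw [hX]
    push_cast
    rw [← pow_mul, mul_comm]
  have hφ1 : 1 ≤ 2 * φ := (hμ ⟨0, hm⟩).half_le
  have hm1 : (1 : ℝ) ≤ m := by exact_mod_cast hm
  have hX1 : (8 : ℝ) ≤ X := by exact_mod_cast hX2
  have hZr : (Z : ℝ) ≤ (X : ℝ) ^ 1030 := by exact_mod_cast hZle
  have hLr : (L : ℝ) ≤ X := by exact_mod_cast hLle
  have hKr : (K : ℝ) ≤ (X : ℝ) ^ K := by exact_mod_cast hKX
  have hnr : (n : ℝ) ≤ X := by exact_mod_cast hnle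
  have hMκ : M / κ ≤ (X : ℝ) ^ K * (X : ℝ) ^ d := by
    rw [div_le_iff₀ hκ0]
    refine hMK.trans ?_
    gcongr
  have hM0 : 0 ≤ M := (abs_nonneg _).trans (hM ⟨0, hm⟩ false false)
  calc (L : ℝ) * (2 * (m * M) / (κ / (4 * φ * Z)) + 1)
      = L * (8 * (φ * m) * (M / κ) * Z + 1) := by field_simp; ring
    _ ≤ L * (8 * (φ * m) * (M / κ) * Z + 2 * (φ * m)) := by
        gcongr
        nlinarith
    _ = φ * m * (L * (8 * ((M / κ) * Z) + 2)) := by ring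
    _ ≤ φ * m * (X * (X * (((X : ℝ) ^ K * (X : ℝ) ^ d) * (X : ℝ) ^ 1030) +
          X * (((X : ℝ) ^ K * (X : ℝ) ^ d) * (X : ℝ) ^ 1030))) := by
        gcongr
        have h1 : (1 : ℝ) ≤ ((X : ℝ) ^ K * (X : ℝ) ^ d) * (X : ℝ) ^ 1030 := by
          rw [← pow_add, ← pow_add]
          exact one_le_pow₀ (by linarith)
        nlinarith
    _ = φ * m * (2 * (X : ℝ) ^ (1032 + K + d)) := by ring
    _ ≤ φ * m * ((X : ℝ) ^ 8 * (X : ℝ) ^ (1032 + K + d)) := by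
        gcongr
        calc (2 : ℝ) ≤ X ^ 1 := by linarith
          _ ≤ X ^ 8 := pow_le_pow_right₀ (by linarith) (by norm_num)
    _ = φ * m * (X : ℝ) ^ (1040 + K + d) := by ring
    _ ≤ _ := by gcongr

end BFOP

/-! ### Max-2CSP and the two kinds of BFOP -/

lemma tendsto_two_div_add_one : Tendsto (fun n : ℕ => 2 / ((n : ℝ) + 1)) atTop (𝓝 0) := by
  have := (tendsto_one_div_add_atTop_nhds_zero_nat (𝕜 := ℝ)).const_mul 2
  simpa [div_eq_mul_inv] using this

/-- A Max-2CSP instance as a BFOP instance. -/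
noncomputable def Max2CSP.toBFOP {n m : ℕ} (I : Max2CSP n m) : BFOP n m where
  scope := I.scope
  func i a b := open Classical in if (a, b) ∈ I.rel i then 1 else 0

lemma Max2CSP.objective_toBFOP {n m : ℕ} (I : Max2CSP n m) : I.toBFOP.objective = I.objective := by
  funext w τ
  simp [BFOP.objective, Max2CSP.objective, Max2CSP.toBFOP]

lemma one_le_abs_of_int {x : ℝ} (h : ∃ z : ℤ, x = z) (hx : x ≠ 0) : 1 ≤ |x| := by
  obtain ⟨z, rfl⟩ := h
  have : z ≠ 0 := by exact_mod_cast hx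
  exact_mod_cast Int.one_le_abs this

lemma BFOP.one_le_abs_mixed {n m : ℕ} {I : BFOP n m} (h : ∀ i a b, ∃ z : ℤ, I.func i a b = z)
    (i : Fin m) (hi : I.mixed i ≠ 0) : 1 ≤ |I.mixed i| := by
  refine one_le_abs_of_int ?_ hi
  obtain ⟨z₁, h₁⟩ := h i true true
  obtain ⟨z₂, h₂⟩ := h i true false
  obtain ⟨z₃, h₃⟩ := h i false true
  obtain ⟨z₄, h₄⟩ := h i false false
  exact ⟨z₁ - z₂ - z₃ + z₄, by simp [BFOP.mixed, h₁, h₂, h₃, h₄]⟩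

/-- A finite set of values has finitely many nonzero mixed differences, so their least absolute
value is a gap common to all instances. -/
lemma exists_gap (R : Finset ℝ) : ∃ κ : ℝ, 0 < κ ∧ ∀ a ∈ R, ∀ b ∈ R, ∀ c ∈ R, ∀ d ∈ R,
    a - b - c + d ≠ 0 → κ ≤ |a - b - c + d| := by
  set F := ((R ×ˢ R ×ˢ R ×ˢ R).image fun p => |p.1 - p.2.1 - p.2.2.1 + p.2.2.2|).filter (0 < ·)
    with hF
  have hmem : ∀ a ∈ R, ∀ b ∈ R, ∀ c ∈ R, ∀ d ∈ R, a - b - c + d ≠ 0 → |a - b - c + d| ∈ F := by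
    intro a ha b hb c hc d hd h
    rw [hF, Finset.mem_filter, Finset.mem_image]
    exact ⟨⟨(a, b, c, d), by simp [ha, hb, hc, hd], rfl⟩, abs_pos.mpr h⟩
  by_cases hne : F.Nonempty
  · refine ⟨F.min' hne, (Finset.mem_filter.mp (F.min'_mem hne)).2, ?_⟩
    exact fun a ha b hb c hc d hd h => F.min'_le _ (hmem a ha b hb c hc d hd h)
  · refine ⟨1, one_pos, fun a ha b hb c hc d hd h => ?_⟩
    exact absurd ⟨_, hmem a ha b hb c hc d hd h⟩ hne

lemma Polynomial.eval_le_mul_pow (q : Polynomial ℕ) {n : ℕ} (hn : 1 ≤ n) :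
    q.eval n ≤ q.eval 1 * n ^ q.natDegree := by
  rw [Polynomial.eval_eq_sum_range, Polynomial.eval_eq_sum_range, Finset.sum_mul]
  refine Finset.sum_le_sum fun i hi => ?_
  rw [Finset.mem_range] at hi
  rw [one_pow, mul_one]
  exact Nat.mul_le_mul_left _ (Nat.pow_le_pow_right hn (by omega))

theorem theorem2 :
    -- Max-2CSP
    (∃ (C : ℝ) (η : ℕ → ℝ), Tendsto η atTop (𝓝 0) ∧
      ∀ (n m : ℕ) (I : Max2CSP n m) (φ : ℝ) (μ : Fin m → Measure ℝ),
        0 < φ → (∀ i, IsSmoothWeightLaw φ (μ i)) →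
        FlipFastWithProb I.objective μ
          (φ * m * (n : ℝ) ^ (C * Real.sqrt (Real.log n))) (1 - η n)) ∧
    -- BFOP, function values in a fixed finite set of reals
    (∀ R : Finset ℝ, ∃ (C : ℝ) (η : ℕ → ℝ), Tendsto η atTop (𝓝 0) ∧
      ∀ (n m : ℕ) (I : BFOP n m) (φ : ℝ) (μ : Fin m → Measure ℝ),
        (∀ i a b, I.func i a b ∈ R) →
        0 < φ → (∀ i, IsSmoothWeightLaw φ (μ i)) →
        FlipFastWithProb I.objective μ
          (φ * m * (n : ℝ) ^ (C * Real.sqrt (Real.log n))) (1 - η n)) ∧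
    -- BFOP, function values in `{0, 1, …, k}` with `k` polynomially bounded in `n`
    (∀ q : Polynomial ℕ, ∃ (C : ℝ) (η : ℕ → ℝ), Tendsto η atTop (𝓝 0) ∧
      ∀ (n m : ℕ) (I : BFOP n m) (φ : ℝ) (μ : Fin m → Measure ℝ),
        (∀ i a b, ∃ v : ℕ, v ≤ q.eval n ∧ I.func i a b = v) →
        0 < φ → (∀ i, IsSmoothWeightLaw φ (μ i)) →
        FlipFastWithProb I.objective μ
          (φ * m * (n : ℝ) ^ (C * Real.sqrt (Real.log n))) (1 - η n)) := by
  refine ⟨?_, fun R => ?_, fun q => ?_⟩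
  · obtain ⟨C, hC⟩ := BFOP.exists_flipFastWithProb 1 0
    refine ⟨C, _, tendsto_two_div_add_one, fun n m I φ μ hφ hμ => ?_⟩
    rw [← I.objective_toBFOP]
    refine hC n m I.toBFOP φ μ 1 1 hφ hμ one_pos (BFOP.one_le_abs_mixed fun i a b => ?_)
      (fun i a b => ?_) (by simp)
    · simp only [Max2CSP.toBFOP]
      split_ifs
      · exact ⟨1, by simp⟩
      · exact ⟨0, by simp⟩
    · simp only [Max2CSP.toBFOP]
      split_ifs <;> simp
  · obtain ⟨κ, hκ0, hκ⟩ := exists_gap R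
    obtain ⟨K, hK⟩ := exists_nat_ge ((∑ r ∈ R, |r|) / κ)
    obtain ⟨C, hC⟩ := BFOP.exists_flipFastWithProb K 0
    refine ⟨C, _, tendsto_two_div_add_one, fun n m I φ μ hR hφ hμ => ?_⟩
    refine hC n m I φ μ κ (∑ r ∈ R, |r|) hφ hμ hκ0 (fun i hi => ?_) (fun i a b => ?_) ?_
    · exact hκ _ (hR i _ _) _ (hR i _ _) _ (hR i _ _) _ (hR i _ _) hi
    · exact Finset.single_le_sum (f := fun r : ℝ => |r|) (fun _ _ => abs_nonneg _) (hR i a b)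
    · rw [pow_zero, mul_one, ← div_le_iff₀ hκ0]
      exact hK
  · obtain ⟨C, hC⟩ := BFOP.exists_flipFastWithProb (q.eval 1) q.natDegree
    refine ⟨C, _, tendsto_two_div_add_one, fun n m I φ μ hq hφ hμ => ?_⟩
    -- The monomial bound on `q` can fail at `n = 0`, where the allowed failure probability is `2`.
    rcases Nat.eq_zero_or_pos n with rfl | hn
    · refine le_trans ?_ measureReal_nonneg
      norm_num
    · refine hC n m I φ μ 1 (q.eval n : ℕ) hφ hμ one_pos (BFOP.one_le_abs_mixed fun i a b => ?_)
        (fun i a b => ?_) ?_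
      · obtain ⟨v, -, hv⟩ := hq i a b
        exact ⟨v, by simp [hv]⟩
      · obtain ⟨v, hv1, hv⟩ := hq i a b
        rw [hv, Nat.abs_cast]
        exact_mod_cast hv1
      · rw [mul_one]
        exact_mod_cast q.eval_le_mul_pow hn
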